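/- Let $X$ be a connected, Hausdorff, paracompact complex manifold of dimension $d$ and let $W:X\to\mathbb{C}$ be a holomorphic function whose critical set $Z_W=\{p\in X : (\partial W)(p)=0\}$ is compact. (This covers every Landau–Ginzburg pair with compact critical set, i.e. the case where, in addition, $X$ is non-compact, Kählerian, with holomorphically trivial canonical bundle, and $W$ is non-constant.) Let $\mathrm{O}(X)$ be the ring of holomorphic functions on $X$ and let $$\mathrm{PV}^k(X)=\bigoplus_{-i+j=k}\mathcal{A}^{j}(X,\wedge^{i}TX),\qquad k\in\mathbb{Z},$$ where $\mathcal{A}^{j}(X,\wedge^{i}TX)$ is the space of smooth $(0,j)$-forms valued in $\wedge^iTX$. Give $\mathrm{PV}(X)=\bigoplus_k\mathrm{PV}^k(X)$ the product $(\rho_1\otimes P_1)(\rho_2\otimes P_2)=(-1)^{ij}(\rho_1\wedge\rho_2)\otimes(P_1\wedge P_2)$ for $P_1$ of degree $i$ and $\rho_2$ of degree $j$. Let $\delta_W=\bar\partial+\iota_W$, where $\bar\partial$ is the Dolbeault operator of the holomorphic bundle $\wedge TX$ and $\iota_W$ is the $C^\infty(X)$-linear odd derivation which vanishes on $(0,\ast)$-forms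 and is the contraction with $-\mathbf{i}\,\partial W$ on vector fields. Let $\mathrm{PV}_c(X)\subset\mathrm{PV}(X)$ consist of the compactly supported elements. Then $(\mathrm{PV}(X),\delta_W)$ and $(\mathrm{PV}_c(X),\delta_W)$ are cochain complexes of $\mathrm{O}(X)$-modules, and the inclusion $i:\mathrm{PV}_c(X)\hookrightarrow\mathrm{PV}(X)$ is a homotopy equivalence, and hence a quasi-isomorphism, of complexes of $\mathrm{O}(X)$-modules. Moreover, smooth Hermitian metrics $G$ on $TX$ exist, as do smooth compactly supported functions $\rho:X\to\mathbb{C}$ equal to $1$ on an open neighbourhood of $Z_W$. For every such $G$ and $\rho$, let $\mathrm{grad}_G\overline W$ be the vector field with $G(\mathrm{grad}_G\overline W,v)=\overline{(\partial W)(v)}$ for all $v\in TX$, put $\|\partial W\|_G^2=G(\mathrm{grad}_G\overline W,\mathrm{grad}_G\overline W)$ and, on $X\setminus Z_W$, $$s=\frac{\mathbf{i}}{\|\partial W\|_G^2}\,\mathrm{grad}_G\overline W,\qquad R=s\sum_{k=0}^d(-1)^k(\bar\partial s)^k .$$ Then $\pi(\omega)=\rho\,\omega+(\bar\partial\rho)R\,\omega$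 defines a morphism of complexes of $\mathrm{O}(X)$-modules $\pi:\mathrm{PV}(X)\to\mathrm{PV}_c(X)$, and $\mathcal{R}(\omega)=(1-\rho)R\,\omega$ defines an $\mathrm{O}(X)$-linear map of degree $-1$ on $\mathrm{PV}(X)$ which preserves $\mathrm{PV}_c(X)$, such that $$\mathrm{id}_{\mathrm{PV}(X)}-i\circ\pi=\delta_W\mathcal{R}+\mathcal{R}\delta_W,\qquad \mathrm{id}_{\mathrm{PV}_c(X)}-\pi\circ i=\delta_W\mathcal{R}_c+\mathcal{R}_c\delta_W,\qquad \mathcal{R}_c=\mathcal{R}|_{\mathrm{PV}_c(X)} .$$ -/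

import Mathlib

open scoped Manifold ContDiff Topology

noncomputable section

namespace PolyvectorForms

/-! ### The fibre: the exterior algebra of `V̄* ⊕ V` -/

/-- `V̄*`: the conjugate-linear functionals on a complex vector space `V`. For `V = T_x X` (the
holomorphic tangent space) this is the fibre of the bundle of `(0,1)`-covectors. -/
abbrev AntiDual (V : Type) [AddCommGroup V] [Module ℂ V] : Type := V →ₗ⋆[ℂ] ℂ

/-- The algebra `⋀(V̄* ⊕ V)`. It is the super tensor product `⋀V̄* ⊗ ⋀V`: the element `ρ * P`, with
`ρ` a product of elements of `V̄*` and `P` a product of elements of `V`, stands for `ρ ⊗ P`, and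
`(ρ₁ ⊗ P₁) (ρ₂ ⊗ P₂) = (-1) ^ (i * j) (ρ₁ ∧ ρ₂) ⊗ (P₁ ∧ P₂)` if `P₁` has degree `i` and `ρ₂` has
degree `j`. -/
abbrev PVAlg (V : Type) [AddCommGroup V] [Module ℂ V] : Type :=
  ExteriorAlgebra ℂ (AntiDual V × V)

section Fibre

variable {V V' : Type} [AddCommGroup V] [Module ℂ V] [AddCommGroup V'] [Module ℂ V']

/-- A `(0,1)`-covector as an element of the algebra. -/
def ofForm (α : AntiDual V) : PVAlg V := ExteriorAlgebra.ι ℂ (α, 0)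

/-- A vector as an element of the algebra. -/
def ofVec (v : V) : PVAlg V := ExteriorAlgebra.ι ℂ (0, v)

variable (V) in
/-- The subspace `⋀^j V̄* ⊗ ⋀^i V`, spanned by the products of `j` elements of `V̄*` and `i` elements
of `V`; its elements have bidegree `(-i, j)`. -/
def bidegree (i j : ℕ) : Submodule ℂ (PVAlg V) :=
  LinearMap.range (ExteriorAlgebra.ι ℂ ∘ₗ LinearMap.inl ℂ (AntiDual V) V) ^ j *
    LinearMap.range (ExteriorAlgebra.ι ℂ ∘ₗ LinearMap.inr ℂ (AntiDual V) V) ^ i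

variable (V) in
/-- The subspace of elements of total degree `k`: the sum of the parts of bidegree `(-i, j)` with
`-i + j = k`. -/
def totalDegree (k : ℤ) : Submodule ℂ (PVAlg V) :=
  ⨆ (i : ℕ) (j : ℕ) (_ : -(i : ℤ) + (j : ℤ) = k), bidegree V i j

/-- The map `V̄* ⊕ V → V̄'* ⊕ V'`, `(α, v) ↦ (α ∘ B, A v)`; it is used for `B = A⁻¹`. -/
def pushGen (A : V →ₗ[ℂ] V') (B : V' →ₗ[ℂ] V) : (AntiDual V × V) →ₗ[ℂ] (AntiDual V' × V') where
  toFun m := (m.1.comp B, A m.2)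
  map_add' m n := by ext <;> simp
  map_smul' c m := by ext <;> simp

/-- The algebra map `⋀(V̄* ⊕ V) → ⋀(V̄'* ⊕ V')` induced by an isomorphism `A` with inverse `B`. -/
def push (A : V →ₗ[ℂ] V') (B : V' →ₗ[ℂ] V) : PVAlg V →ₐ[ℂ] PVAlg V' :=
  ExteriorAlgebra.map (pushGen A B)

end Fibre

/-! ### Calculus on the model space `ℂ^d` -/

/-- The model space `ℂ^d`. -/
abbrev Model (d : ℕ) : Type := EuclideanSpace ℂ (Fin d)

section Model

variable (d : ℕ)

instance finite_antiDual : Module.Finite ℂ (AntiDual (Model d)) := by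
  let f : AntiDual (Model d) →ₗ[ℂ] (Fin d → ℂ) :=
    { toFun := fun α r => α (EuclideanSpace.single r 1)
      map_add' := fun _ _ => rfl
      map_smul' := fun _ _ => rfl }
  refine Module.Finite.of_injective f ?_
  intro α β h
  refine LinearMap.ext fun v => ?_
  have hv : v = ∑ r, v r • (EuclideanSpace.single r (1 : ℂ) : Model d) := by
    ext s
    simp [Finset.sum_apply, Pi.single_apply]
  rw [hv, map_sum, map_sum]
  refine Finset.sum_congr rfl fun r _ => ?_
  rw [map_smulₛₗ, map_smulₛₗ]
  exact congrArg _ (congrFun h r)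

/-- A basis of the algebra `⋀(V̄* ⊕ V)` for `V = ℂ^d`. -/
def pvBasis : Module.Basis (Finset (Fin (Module.finrank ℂ (AntiDual (Model d) × Model d)))) ℂ
    (PVAlg (Model d)) :=
  (Module.finBasis ℂ (AntiDual (Model d) × Model d)).ExteriorAlgebra

/-- The sup norm with respect to a basis; as the space is finite-dimensional, the choice does not
affect smoothness and derivatives. -/
instance normedAddCommGroupPV : NormedAddCommGroup (PVAlg (Model d)) :=
  NormedAddCommGroup.induced _ _ (pvBasis d).equivFun.toLinearMap (pvBasis d).equivFun.injective

instance normedSpacePV : NormedSpace ℂ (PVAlg (Model d)) :=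
  NormedSpace.induced ℂ _ _ (pvBasis d).equivFun.toLinearMap

/-- The conjugate-linear coordinate `d z̄_r` on `ℂ^d`. -/
def dzbar (r : Fin d) : AntiDual (Model d) where
  toFun v := starRingEnd ℂ (v r)
  map_add' v w := by simp
  map_smul' c v := by simp

variable {d}

/-- `∂f / ∂z̄_r = ½ (∂f / ∂x_r + i ∂f / ∂y_r)` at `p`. -/
def partialBar (r : Fin d) (f : Model d → PVAlg (Model d)) (p : Model d) : PVAlg (Model d) :=
  (1 / 2 : ℂ) • (fderiv ℝ f p (EuclideanSpace.single r 1) +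
    Complex.I • fderiv ℝ f p (EuclideanSpace.single r Complex.I))

/-- The Dolbeault operator on `ℂ^d`: `∂̄ f = ∑ r, d z̄_r ∧ ∂f / ∂z̄_r`. -/
def dbarModel (f : Model d → PVAlg (Model d)) (p : Model d) : PVAlg (Model d) :=
  ∑ r, ofForm (dzbar d r) * partialBar r f p

end Model

/-! ### Polyvector-valued forms on a complex manifold -/

section Manifold

variable (d : ℕ) {X : Type*} [TopologicalSpace X] [ChartedSpace (Model d) X]

/-- The holomorphic tangent space `T_x X`. -/
abbrev TX (x : X) : Type := TangentSpace 𝓘(ℂ, Model d) x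

/-- The fibre `(⋀T̄* ⊗ ⋀T)_x` of the bundle of polyvector-valued `(0,*)`-forms. -/
abbrev PVFiber (x : X) : Type := PVAlg (TX d x)

variable (X) in
/-- Set-theoretic sections of the bundle `⋀T̄*X ⊗ ⋀TX`, without any smoothness. -/
def RoughSection : Type _ := ∀ x : X, PVFiber d x

instance : AddCommGroup (RoughSection d X) := inferInstanceAs (AddCommGroup (∀ x : X, PVFiber d x))

variable (X) in
/-- The ring `O(X)` of holomorphic functions on `X`. -/
abbrev HolFun : Type _ := C^ω⟮𝓘(ℂ, Model d), X; 𝓘(ℂ), ℂ⟯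

/-- `O(X)` acts on sections pointwise. -/
instance : Module (HolFun d X) (RoughSection d X) where
  smul f σ := fun x => f x • σ x
  one_smul σ := funext fun x => one_smul ℂ (σ x)
  mul_smul f g σ := funext fun x => mul_smul (f x) (g x) (σ x)
  smul_zero f := funext fun x => smul_zero (f x)
  smul_add f σ τ := funext fun x => smul_add (f x) (σ x) (τ x)
  add_smul f g σ := funext fun x => add_smul (f x) (g x) (σ x)
  zero_smul σ := funext fun x => zero_smul ℂ (σ x)

variable [IsManifold 𝓘(ℂ, Model d) ω X]

/-- The holomorphic trivialization `T_x X → ℂ^d` of the tangent bundle by the chart at `x₀`, that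
is, the differential of that chart (for `x` in its domain). -/
def toModel (x₀ x : X) : TX d x →ₗ[ℂ] Model d :=
  (trivializationAt (Model d) (TangentSpace 𝓘(ℂ, Model d)) x₀).continuousLinearMapAt ℂ x

/-- The inverse `ℂ^d → T_x X` of the trivialization by the chart at `x₀`. -/
def ofModel (x₀ x : X) : Model d →ₗ[ℂ] TX d x :=
  (trivializationAt (Model d) (TangentSpace 𝓘(ℂ, Model d)) x₀).symmL ℂ x

variable {d}

/-- The coordinate expression of a section in the chart at `x₀`: a map from (the image of the chart
in) `ℂ^d` to the algebra `⋀(V̄* ⊕ V)` with `V = ℂ^d`. -/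
def inChart (x₀ : X) (σ : RoughSection d X) (p : Model d) : PVAlg (Model d) :=
  let x := (extChartAt 𝓘(ℂ, Model d) x₀).symm p
  push (toModel d x₀ x) (ofModel d x₀ x) (σ x)

/-- A section is smooth if its coordinate expressions are smooth (in the real sense). -/
def IsSmooth (σ : RoughSection d X) : Prop :=
  ∀ x₀ : X, ContDiffOn ℝ ∞ (inChart x₀ σ) (extChartAt 𝓘(ℂ, Model d) x₀).target

/-- The Dolbeault operator `∂̄` of the holomorphic bundle `⋀TX`, computed at `x` in the chart
at `x`. -/
def dbar (σ : RoughSection d X) : RoughSection d X := fun x =>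
  push (ofModel d x x) (toModel d x x)
    (dbarModel (inChart x σ) (extChartAt 𝓘(ℂ, Model d) x x))

/-- The differential `∂W` at `x` as a `ℂ`-linear functional on `T_x X`. -/
def dHol (W : X → ℂ) (x : X) : TX d x →ₗ[ℂ] ℂ :=
  (mvfderiv 𝓘(ℂ, Model d) W x).toLinearMap

/-- The operator `ι_W`: the odd derivation which is the contraction with `-i ∂W` on vectors and zero
on `(0,*)`-forms. -/
def iotaW (W : X → ℂ) (σ : RoughSection d X) : RoughSection d X := fun x =>
  CliffordAlgebra.contractLeft ((-Complex.I) • (dHol W x ∘ₗ LinearMap.snd ℂ (AntiDual (TX d x)) _))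
    (σ x)

/-- The twisted differential `δ_W = ∂̄ + ι_W`. -/
def twistedDiff (W : X → ℂ) (σ : RoughSection d X) : RoughSection d X := dbar σ + iotaW W σ

variable (d) in
/-- The critical set `Z_W` of `W`. -/
def criticalSet (W : X → ℂ) : Set X := {x | dHol (d := d) W x = 0}

lemma inChart_add (x₀ : X) (σ τ : RoughSection d X) :
    inChart x₀ (σ + τ) = inChart x₀ σ + inChart x₀ τ :=
  funext fun _ => map_add (push _ _) _ _

lemma inChart_smul (x₀ : X) (f : HolFun d X) (σ : RoughSection d X) :
    inChart x₀ (f • σ) =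
      fun p => f ((extChartAt 𝓘(ℂ, Model d) x₀).symm p) • inChart x₀ σ p :=
  funext fun _ => map_smul (push (toModel d x₀ _) (ofModel d x₀ _)) (f _) (σ _)

lemma IsSmooth.zero : IsSmooth (0 : RoughSection d X) := fun x₀ => by
  have : inChart x₀ (0 : RoughSection d X) = fun _ => 0 := funext fun _ => map_zero (push _ _)
  rw [this]
  exact contDiffOn_const

lemma IsSmooth.add {σ τ : RoughSection d X} (hσ : IsSmooth σ) (hτ : IsSmooth τ) :
    IsSmooth (σ + τ) := fun x₀ => by
  rw [inChart_add]
  exact (hσ x₀).add (hτ x₀)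

lemma IsSmooth.smul (f : HolFun d X) {σ : RoughSection d X} (hσ : IsSmooth σ) :
    IsSmooth (f • σ) := fun x₀ => by
  rw [inChart_smul]
  have : IsScalarTower ℝ ℂ (PVAlg (Model d)) := inferInstance
  have h : ContDiffOn ℂ ω (f ∘ (extChartAt 𝓘(ℂ, Model d) x₀).symm)
      (extChartAt 𝓘(ℂ, Model d) x₀).target :=
    (f.contMDiff.comp_contMDiffOn (contMDiffOn_extChartAt_symm x₀)).contDiffOn
  exact ((h.restrict_scalars ℝ).of_le le_top).smul (hσ x₀)

variable (d X) in
/-- `PV^k(X)`: smooth polyvector-valued forms of total degree `k`, as an `O(X)`-module. -/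
def PV (k : ℤ) : Submodule (HolFun d X) (RoughSection d X) where
  carrier := {σ | IsSmooth σ ∧ ∀ x, σ x ∈ totalDegree (TX d x) k}
  zero_mem' := ⟨IsSmooth.zero, fun _ => Submodule.zero_mem _⟩
  add_mem' hσ hτ := ⟨hσ.1.add hτ.1, fun x => Submodule.add_mem _ (hσ.2 x) (hτ.2 x)⟩
  smul_mem' f _ hσ := ⟨hσ.1.smul f, fun x => Submodule.smul_mem _ (f x) (hσ.2 x)⟩

variable (d X) in
/-- `PV_c^k(X)`: the compactly supported elements of `PV^k(X)`. -/
def PVc (k : ℤ) : Submodule (HolFun d X) (RoughSection d X) where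
  carrier := {σ | σ ∈ PV d X k ∧ IsCompact (closure {x | σ x ≠ 0})}
  zero_mem' := ⟨Submodule.zero_mem _, by
    have : {x : X | (0 : RoughSection d X) x ≠ 0} = ∅ :=
      Set.eq_empty_of_forall_notMem fun x hx => hx rfl
    rw [this, closure_empty]
    exact isCompact_empty⟩
  add_mem' {σ τ} hσ hτ := ⟨Submodule.add_mem _ hσ.1 hτ.1, by
    refine (hσ.2.union hτ.2).of_isClosed_subset isClosed_closure ?_
    rw [← closure_union]
    refine closure_mono fun x hx => ?_
    by_contra h
    simp only [Set.mem_union, Set.mem_ofPred_eq, not_or, not_not] at h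
    exact hx ((congrArg₂ (· + ·) h.1 h.2).trans (add_zero _))⟩
  smul_mem' f σ hσ := ⟨Submodule.smul_mem _ f hσ.1, by
    refine hσ.2.of_isClosed_subset isClosed_closure (closure_mono fun x hx h => hx ?_)
    exact (congrArg (f x • ·) h).trans (smul_zero _)⟩

/-- The inclusion `PV_c^k(X) → PV^k(X)`. -/
def incl (k : ℤ) : PVc d X k →ₗ[HolFun d X] PV d X k :=
  Submodule.inclusion fun _ h => h.1

/-! ### The explicit homotopy inverse and homotopies -/

variable (d X) in
/-- A smooth Hermitian metric on the holomorphic tangent bundle `TX`. -/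
structure HermitianMetric where
  /-- The pairing `h_x(u, v)`, linear in `u` and conjugate-linear in `v`. -/
  h : ∀ x : X, TX d x →ₗ[ℂ] TX d x →ₗ⋆[ℂ] ℂ
  conj_symm : ∀ x u v, h x v u = starRingEnd ℂ (h x u v)
  pos : ∀ x u, u ≠ 0 → 0 < (h x u u).re
  smooth : ∀ (x₀ : X) (u v : Model d), ContDiffOn ℝ ∞
    (fun p => let x := (extChartAt 𝓘(ℂ, Model d) x₀).symm p
      h x (ofModel d x₀ x u) (ofModel d x₀ x v))
    (extChartAt 𝓘(ℂ, Model d) x₀).target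

/-- The gradient of `W̄`: the vector field determined by `h(grad W̄, v) = (∂̄W̄)(v̄) = conj (∂W(v))`
for all `v`. -/
def gradBar (G : HermitianMetric d X) (W : X → ℂ) (x : X) : TX d x :=
  Classical.epsilon fun g => ∀ v, G.h x g v = starRingEnd ℂ (dHol W x v)

/-- `‖∂W‖² = h(grad W̄, grad W̄)`. -/
def normSqdHol (G : HermitianMetric d X) (W : X → ℂ) (x : X) : ℂ :=
  G.h x (gradBar G W x) (gradBar G W x)

/-- The section `s = i ‖∂W‖⁻² grad W̄` of `TX` over the complement of `Z_W`, as a polyvector-valued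
form (its values on `Z_W` are irrelevant). -/
def sField (G : HermitianMetric d X) (W : X → ℂ) : RoughSection d X := fun x =>
  ofVec ((Complex.I / normSqdHol G W x) • gradBar G W x)

/-- `R = s (1 + ∂̄s)⁻¹ = s ∑_{k ≤ d} (-1)^k (∂̄s)^k` over the complement of `Z_W`. -/
def bigR (G : HermitianMetric d X) (W : X → ℂ) : RoughSection d X := fun x =>
  sField G W x * ∑ k ∈ Finset.range (d + 1), (-1) ^ k * (dbar (sField G W) x) ^ k

/-- A cutoff function for `Z_W`: smooth, compactly supported, equal to `1` on an open neighbourhood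
of `Z_W`. -/
structure IsCutoff (W : X → ℂ) (ρ : X → ℂ) : Prop where
  smooth : ContMDiff 𝓘(ℝ, Model d) 𝓘(ℝ, ℂ) ∞ ρ
  compact : HasCompactSupport ρ
  eq_one : ∃ U₁ : Set X, IsOpen U₁ ∧ criticalSet d W ⊆ U₁ ∧ ∀ x ∈ U₁, ρ x = 1

/-- The operator `(1 - ρ) R`. -/
def homotopyOp (G : HermitianMetric d X) (W ρ : X → ℂ) (σ : RoughSection d X) : RoughSection d X :=
  fun x => (1 - ρ x) • (bigR G W x * σ x)

/-- The operator `π = ρ + (∂̄ρ) R`. -/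
def inverseOp (G : HermitianMetric d X) (W ρ : X → ℂ) (σ : RoughSection d X) : RoughSection d X :=
  fun x => ρ x • σ x +
    dbar (d := d) (fun y : X => (algebraMap ℂ (PVFiber d y) (ρ y) : PVFiber d y)) x *
      (bigR G W x * σ x)

/-! ### Complexes of `O(X)`-modules -/

/-- The cochain complex with terms `M k` and differentials `D k`. -/
abbrev complexOf (M : ℤ → Submodule (HolFun d X) (RoughSection d X))
    (D : ∀ k, M k →ₗ[HolFun d X] M (k + 1)) (hD : ∀ k, D (k + 1) ∘ₗ D k = 0) :
    CochainComplex (ModuleCat (HolFun d X)) ℤ :=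
  CochainComplex.of (fun k => ModuleCat.of (HolFun d X) (M k)) (fun k => ModuleCat.ofHom (D k))
    fun k => by rw [← ModuleCat.ofHom_comp, hD k]; rfl

end Manifold

end PolyvectorForms

end

open scoped Manifold ContDiff Topology

noncomputable section

namespace PolyvectorForms

/-! ### Algebra of the fibre -/

section Fibre

open CliffordAlgebra (contractLeft involute)

/-! ### Grading involution and contraction on an exterior algebra -/

section Exterior

variable {M : Type} [AddCommGroup M] [Module ℂ M]

/-! Away from `Z_W` the twisted complex has an explicit contraction. The field `s` is normalised so
that `ι_W s = 1` (`iotaW_sField`), whence `δ_W s = 1 + ∂̄s`. The element `∂̄s` is even, of bidegree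
`(-1, 1)`, and its power `d + 1` vanishes because `⋀^(d+1) TX = 0`; so `1 + ∂̄s` has the finite
geometric series `g = ∑ (-1)^k (∂̄s)^k` as inverse. From `δ_W (1 + ∂̄s) = δ_W² s = 0` and `(1 + ∂̄s)
g = 1` follows `δ_W g = 0`, so `R = s g` satisfies `δ_W R = 1` (`twistedDiff_bigR`). As `R` is odd,
the Leibniz rule gives `δ_W (R ω) + R δ_W ω = ω`.

Cutting off with `1 - ρ`, which vanishes near `Z_W`, makes `𝓡 = (1 - ρ) R` a smooth operator on all
of `X`. The Leibniz rule now produces the additional term `-(∂̄ρ) R ω`, and the result is `δ_W 𝓡 + 𝓡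
δ_W = 1 - ρ - (∂̄ρ) R = 1 - π` (`twistedDiff_homotopyOp`). Smoothness of `π`, its degree and its
compatibility with `δ_W` are read off from this identity. Its values are supported in the support of
`ρ`, and `𝓡` does not enlarge supports, so the same identity serves on `PV_c(X)`.

What remains is the calculus behind these formulas. The operator `dbar` is defined at each point in
the chart at that point, so the main analytic fact is that any chart gives the same answer
(`inChart_dbar`, by way of `dbarModel_coordChange`). It reduces the Leibniz rule, `∂̄² = 0` and `∂̄
ι_W = -ι_W ∂̄` to Wirtinger calculus on `ℂ^d`. Metrics and cutoffs come from partitions of unity and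
bump functions, available because a connected paracompact manifold is `σ`-compact. -/

/-- Generators anticommute, so moving one past `x` costs the parity of `x`. This is the source of
the sign in the Leibniz rule for `∂̄`. -/
theorem ι_mul_eq_involute_mul_ι (m : M) (x : ExteriorAlgebra ℂ M) :
    ExteriorAlgebra.ι ℂ m * x = involute x * ExteriorAlgebra.ι ℂ m := by
  induction x using ExteriorAlgebra.induction with
  | algebraMap r => rw [AlgHom.commutes, Algebra.commutes]
  | ι n =>
    have h := ExteriorAlgebra.ι_add_mul_swap (R := ℂ) m n
    rw [show involute (ExteriorAlgebra.ι ℂ n) = -ExteriorAlgebra.ι ℂ n from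
      CliffordAlgebra.involute_ι n, neg_mul]
    exact eq_neg_of_add_eq_zero_left h
  | mul a b ha hb => rw [← mul_assoc, ha, mul_assoc, hb, map_mul, mul_assoc]
  | add a b ha hb => rw [mul_add, ha, hb, map_add, add_mul]

/-- The induction is on `x` with `y` arbitrary: for `x = a * b` the hypothesis on `a` is needed
against `b * y` as well as against `b`. -/
theorem contractLeft_mul (η : Module.Dual ℂ M) (x y : ExteriorAlgebra ℂ M) :
    contractLeft η (x * y) = contractLeft η x * y + involute x * contractLeft η y := by
  induction x using ExteriorAlgebra.induction generalizing y with
  | algebraMap r =>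
    rw [CliffordAlgebra.contractLeft_algebraMap_mul, CliffordAlgebra.contractLeft_algebraMap,
      AlgHom.commutes, zero_mul, zero_add]
  | ι n =>
    rw [CliffordAlgebra.contractLeft_ι_mul, CliffordAlgebra.contractLeft_ι,
      show involute (ExteriorAlgebra.ι ℂ n) = -ExteriorAlgebra.ι ℂ n from
      CliffordAlgebra.involute_ι n, Algebra.smul_def, neg_mul, sub_eq_add_neg]
  | mul a b ha hb =>
    rw [mul_assoc, ha, hb, ha, map_mul]
    noncomm_ring
  | add a b ha hb =>
    rw [add_mul, map_add, map_add, ha, hb, map_add]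
    noncomm_ring

theorem map_involute {N : Type} [AddCommGroup N] [Module ℂ N] (f : M →ₗ[ℂ] N)
    (x : ExteriorAlgebra ℂ M) :
    ExteriorAlgebra.map f (involute x) = involute (ExteriorAlgebra.map f x) := by
  induction x using ExteriorAlgebra.induction with
  | algebraMap r => simp
  | ι n =>
    rw [ExteriorAlgebra.map_apply_ι, show involute (ExteriorAlgebra.ι ℂ n) =
      -ExteriorAlgebra.ι ℂ n from CliffordAlgebra.involute_ι n, map_neg,
      ExteriorAlgebra.map_apply_ι]
    exact (CliffordAlgebra.involute_ι _).symm
  | mul a b ha hb => rw [map_mul, map_mul, ha, hb, map_mul, map_mul]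
  | add a b ha hb => rw [map_add, map_add, ha, hb, map_add, map_add]

theorem map_contractLeft {N : Type} [AddCommGroup N] [Module ℂ N] (f : M →ₗ[ℂ] N)
    (η : Module.Dual ℂ M) (θ : Module.Dual ℂ N) (h : θ ∘ₗ f = η) (x : ExteriorAlgebra ℂ M) :
    ExteriorAlgebra.map f (contractLeft η x) = contractLeft θ (ExteriorAlgebra.map f x) := by
  subst h
  induction x using ExteriorAlgebra.induction with
  | algebraMap r => simp [CliffordAlgebra.contractLeft_algebraMap]
  | ι n =>
    rw [ExteriorAlgebra.map_apply_ι, CliffordAlgebra.contractLeft_ι,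
      CliffordAlgebra.contractLeft_ι, AlgHom.commutes]
    rfl
  | mul a b ha hb =>
    rw [contractLeft_mul, map_add, map_mul, map_mul, ha, hb, map_involute, ← contractLeft_mul,
      ← map_mul]
  | add a b ha hb => rw [map_add, map_add, ha, hb, map_add, map_add]

end Exterior

variable {V V' V'' : Type} [AddCommGroup V] [Module ℂ V] [AddCommGroup V'] [Module ℂ V']
  [AddCommGroup V''] [Module ℂ V'']

/-! ### Functoriality of the fibre algebra -/

theorem push_ofForm (A : V →ₗ[ℂ] V') (B : V' →ₗ[ℂ] V) (α : AntiDual V) :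
    push A B (ofForm α) = ofForm (α.comp B) := by
  rw [push, ofForm, ExteriorAlgebra.map_apply_ι]
  exact congrArg _ (Prod.ext rfl (map_zero A))

theorem push_ofVec (A : V →ₗ[ℂ] V') (B : V' →ₗ[ℂ] V) (v : V) :
    push A B (ofVec v) = ofVec (A v) := by
  rw [push, ofVec, ExteriorAlgebra.map_apply_ι]
  exact congrArg _ (Prod.ext (LinearMap.zero_comp B) rfl)

theorem push_push (A : V →ₗ[ℂ] V') (B : V' →ₗ[ℂ] V) (A' : V' →ₗ[ℂ] V'') (B' : V'' →ₗ[ℂ] V')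
    (x : PVAlg V) : push A' B' (push A B x) = push (A' ∘ₗ A) (B ∘ₗ B') x := by
  have := congrArg (fun f => f x) (ExteriorAlgebra.map_comp_map (pushGen A B) (pushGen A' B'))
  exact this

theorem push_id (x : PVAlg V) : push LinearMap.id LinearMap.id x = x := by
  have := congrArg (fun f => f x) (ExteriorAlgebra.map_id (R := ℂ) (M := AntiDual V × V))
  exact this

theorem push_push_cancel {A : V →ₗ[ℂ] V'} {B : V' →ₗ[ℂ] V} (h : B ∘ₗ A = LinearMap.id)
    (x : PVAlg V) : push B A (push A B x) = x := by
  rw [push_push, h, push_id]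

theorem push_involute (A : V →ₗ[ℂ] V') (B : V' →ₗ[ℂ] V) (x : PVAlg V) :
    push A B (involute x) = involute (push A B x) := map_involute _ _

/-- Contraction is natural, and `η ∘ₗ B` pulls back along `A` to `η`. -/
theorem push_contractLeft {A : V →ₗ[ℂ] V'} {B : V' →ₗ[ℂ] V} (h : B ∘ₗ A = LinearMap.id)
    (η : V →ₗ[ℂ] ℂ) (x : PVAlg V) :
    push A B (contractLeft (η ∘ₗ LinearMap.snd ℂ (AntiDual V) V) x) =
      contractLeft ((η ∘ₗ B) ∘ₗ LinearMap.snd ℂ (AntiDual V') V') (push A B x) := by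
  refine map_contractLeft _ _ _ (LinearMap.ext fun m => ?_) x
  exact congrArg η (congrArg (fun f => f m.2) h)

theorem ofForm_mul_eq (α : AntiDual V) (x : PVAlg V) :
    ofForm α * x = involute x * ofForm α := ι_mul_eq_involute_mul_ι _ _

theorem involute_ofForm (α : AntiDual V) : involute (ofForm α) = -ofForm α :=
  CliffordAlgebra.involute_ι _

theorem involute_ofVec (v : V) : involute (ofVec v) = -ofVec v :=
  CliffordAlgebra.involute_ι _

theorem ofForm_mul_ofForm_comm (α β : AntiDual V) :
    ofForm α * ofForm β = -(ofForm β * ofForm α) :=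
  eq_neg_of_add_eq_zero_left (ExteriorAlgebra.ι_add_mul_swap (R := ℂ) _ _)

/-- `α ↦ ofForm α` as a linear map. -/
def ofFormₗ : AntiDual V →ₗ[ℂ] PVAlg V := ExteriorAlgebra.ι ℂ ∘ₗ LinearMap.inl ℂ (AntiDual V) V

/-- `v ↦ ofVec v` as a linear map. -/
def ofVecₗ : V →ₗ[ℂ] PVAlg V := ExteriorAlgebra.ι ℂ ∘ₗ LinearMap.inr ℂ (AntiDual V) V

theorem ofFormₗ_apply (α : AntiDual V) : ofFormₗ α = ofForm α := rfl

theorem ofVecₗ_apply (v : V) : ofVecₗ v = ofVec v := rfl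

/-- Induction over products of covectors and vectors. -/
theorem pvAlg_induction {C : PVAlg V → Prop} (algebraMap : ∀ r : ℂ, C (algebraMap ℂ _ r))
    (form : ∀ α, C (ofForm α)) (vec : ∀ v, C (ofVec v))
    (mul : ∀ a b, C a → C b → C (a * b)) (add : ∀ a b, C a → C b → C (a + b)) (x : PVAlg V) :
    C x := by
  induction x using ExteriorAlgebra.induction with
  | algebraMap r => exact algebraMap r
  | ι m =>
    have : ExteriorAlgebra.ι ℂ m = ofForm m.1 + ofVec m.2 := by
      rw [ofForm, ofVec, ← map_add]; simp
    rw [this]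
    exact add _ _ (form _) (vec _)
  | mul a b ha hb => exact mul a b ha hb
  | add a b ha hb => exact add a b ha hb

theorem contractLeft_snd_ofForm (η : V →ₗ[ℂ] ℂ) (α : AntiDual V) :
    contractLeft (η ∘ₗ LinearMap.snd ℂ (AntiDual V) V) (ofForm α) = 0 := by
  rw [ofForm, ExteriorAlgebra.ι, CliffordAlgebra.contractLeft_ι]
  simp

theorem contractLeft_snd_ofVec (η : V →ₗ[ℂ] ℂ) (v : V) :
    contractLeft (η ∘ₗ LinearMap.snd ℂ (AntiDual V) V) (ofVec v) = algebraMap ℂ _ (η v) := by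
  rw [ofVec, ExteriorAlgebra.ι, CliffordAlgebra.contractLeft_ι]
  simp

theorem contractLeft_snd_ofForm_mul (η : V →ₗ[ℂ] ℂ) (α : AntiDual V) (x : PVAlg V) :
    contractLeft (η ∘ₗ LinearMap.snd ℂ (AntiDual V) V) (ofForm α * x) =
      -(ofForm α * contractLeft (η ∘ₗ LinearMap.snd ℂ (AntiDual V) V) x) := by
  rw [contractLeft_mul, contractLeft_snd_ofForm, involute_ofForm, zero_mul, zero_add, neg_mul]

/-! #### Degrees -/

/-- Covectors and vectors only anticommute, but subspaces absorb the sign. This is what makes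
bidegrees add under multiplication. -/
theorem formRange_commute_vecRange :
    Commute (LinearMap.range (ofFormₗ (V := V))) (LinearMap.range (ofVecₗ (V := V))) := by
  have key (α : AntiDual V) (v : V) : ofForm α * ofVec v = -(ofVec v * ofForm α) :=
    eq_neg_of_add_eq_zero_left (ExteriorAlgebra.ι_add_mul_swap (R := ℂ) _ _)
  refine le_antisymm (Submodule.mul_le.2 ?_) (Submodule.mul_le.2 ?_)
  · rintro _ ⟨α, rfl⟩ _ ⟨v, rfl⟩
    rw [ofFormₗ_apply, ofVecₗ_apply, key]
    exact neg_mem (Submodule.mul_mem_mul ⟨v, rfl⟩ ⟨α, rfl⟩)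
  · rintro _ ⟨v, rfl⟩ _ ⟨α, rfl⟩
    rw [ofFormₗ_apply, ofVecₗ_apply, ← neg_neg (ofVec v * _), ← key]
    exact neg_mem (Submodule.mul_mem_mul ⟨α, rfl⟩ ⟨v, rfl⟩)

theorem bidegree_eq (i j : ℕ) : bidegree V i j =
    LinearMap.range (ofFormₗ (V := V)) ^ j * LinearMap.range (ofVecₗ (V := V)) ^ i := rfl

theorem bidegree_mul_bidegree (i j i' j' : ℕ) :
    bidegree V i j * bidegree V i' j' = bidegree V (i + i') (j + j') := by
  simp only [bidegree_eq]
  rw [mul_assoc, ← mul_assoc (_ ^ i), (formRange_commute_vecRange.pow_pow j' i).symm.eq,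
    mul_assoc, ← pow_add, ← mul_assoc, ← pow_add]

theorem mul_mem_bidegree {i j i' j' : ℕ} {x y : PVAlg V} (hx : x ∈ bidegree V i j)
    (hy : y ∈ bidegree V i' j') : x * y ∈ bidegree V (i + i') (j + j') :=
  bidegree_mul_bidegree (V := V) i j i' j' ▸ Submodule.mul_mem_mul hx hy

theorem bidegree_zero_zero : bidegree V 0 0 = 1 := by
  rw [bidegree_eq, pow_zero, pow_zero, one_mul]

theorem algebraMap_mem_bidegree (r : ℂ) : algebraMap ℂ (PVAlg V) r ∈ bidegree V 0 0 := by
  rw [bidegree_zero_zero]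
  exact Submodule.algebraMap_mem r

theorem ofForm_mem_bidegree (α : AntiDual V) : ofForm α ∈ bidegree V 0 1 := by
  rw [bidegree_eq, pow_zero, pow_one, mul_one]
  exact ⟨α, rfl⟩

theorem ofVec_mem_bidegree (v : V) : ofVec v ∈ bidegree V 1 0 := by
  rw [bidegree_eq, pow_zero, pow_one, one_mul]
  exact ⟨v, rfl⟩

theorem pow_mem_bidegree {i j : ℕ} {x : PVAlg V} (hx : x ∈ bidegree V i j) (n : ℕ) :
    x ^ n ∈ bidegree V (n * i) (n * j) := by
  induction n with
  | zero => simpa using algebraMap_mem_bidegree (V := V) 1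
  | succ n ih =>
    rw [pow_succ, add_mul, add_mul, one_mul, one_mul]
    exact mul_mem_bidegree ih hx

theorem push_mem_bidegree (A : V →ₗ[ℂ] V') (B : V' →ₗ[ℂ] V) {i j : ℕ} {x : PVAlg V}
    (hx : x ∈ bidegree V i j) : push A B x ∈ bidegree V' i j := by
  have h : Submodule.map (push A B).toLinearMap (bidegree V i j) ≤ bidegree V' i j := by
    rw [bidegree_eq, bidegree_eq, Submodule.map_mul, Submodule.map_pow, Submodule.map_pow]
    refine mul_le_mul' (pow_le_pow_left' ?_ _) (pow_le_pow_left' ?_ _)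
    · rintro _ ⟨_, ⟨α, rfl⟩, rfl⟩
      exact ⟨α.comp B, (push_ofForm A B α).symm⟩
    · rintro _ ⟨_, ⟨v, rfl⟩, rfl⟩
      exact ⟨A v, (push_ofVec A B v).symm⟩
  exact h ⟨x, hx, rfl⟩

theorem bidegree_le_totalDegree {i j : ℕ} {k : ℤ} (h : -(i : ℤ) + j = k) :
    bidegree V i j ≤ totalDegree V k :=
  le_iSup_of_le i (le_iSup_of_le j (le_iSup_of_le h le_rfl))

theorem totalDegree_induction {k : ℤ} {C : PVAlg V → Prop}
    (mem : ∀ (i j : ℕ), -(i : ℤ) + j = k → ∀ x ∈ bidegree V i j, C x)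
    (zero : C 0) (add : ∀ a b, C a → C b → C (a + b)) {x : PVAlg V} (hx : x ∈ totalDegree V k) :
    C x := by
  refine Submodule.iSup_induction _ (motive := C) hx (fun i y hy => ?_) zero add
  refine Submodule.iSup_induction _ (motive := C) hy (fun j z hz => ?_) zero add
  exact Submodule.iSup_induction _ (motive := C) hz (fun h w hw => mem i j h w hw) zero add

theorem mul_mem_totalDegree {k l : ℤ} {x y : PVAlg V} (hx : x ∈ totalDegree V k)
    (hy : y ∈ totalDegree V l) : x * y ∈ totalDegree V (k + l) := by
  refine totalDegree_induction (C := fun x => x * y ∈ totalDegree V (k + l))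
    (fun i j h x hx => ?_) ?_ ?_ hx
  · refine totalDegree_induction (C := fun y => x * y ∈ totalDegree V (k + l))
      (fun i' j' h' y hy => ?_) ?_ ?_ hy
    · exact bidegree_le_totalDegree (by push_cast; omega) (mul_mem_bidegree hx hy)
    · rw [mul_zero]; exact zero_mem _
    · intro a b ha hb; rw [mul_add]; exact add_mem ha hb
  · rw [zero_mul]; exact zero_mem _
  · intro a b ha hb; rw [add_mul]; exact add_mem ha hb

theorem push_mem_totalDegree (A : V →ₗ[ℂ] V') (B : V' →ₗ[ℂ] V) {k : ℤ} {x : PVAlg V}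
    (hx : x ∈ totalDegree V k) : push A B x ∈ totalDegree V' k := by
  refine totalDegree_induction (C := fun x => push A B x ∈ totalDegree V' k)
    (fun i j h x hx => ?_) ?_ ?_ hx
  · exact bidegree_le_totalDegree h (push_mem_bidegree A B hx)
  · rw [map_zero]; exact zero_mem _
  · intro a b ha hb; rw [map_add]; exact add_mem ha hb

theorem involute_of_mem_bidegree {i j : ℕ} {x : PVAlg V} (hx : x ∈ bidegree V i j) :
    involute x = (-1 : ℂ) ^ (i + j) • x := by
  have pow (N : Submodule ℂ (PVAlg V)) (hN : ∀ y ∈ N, involute y = -y) (n : ℕ) :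
      ∀ y ∈ N ^ n, involute y = (-1 : ℂ) ^ n • y := by
    intro y hy
    induction hy using Submodule.pow_induction_on_left' with
    | algebraMap r => simp
    | add x y i _ _ hx hy => rw [map_add, hx, hy, smul_add]
    | mem_mul m hm i x _ hx =>
      rw [map_mul, hN m hm, hx, Nat.succ_eq_add_one, pow_succ]
      simp
  refine Submodule.mul_induction_on hx (fun a ha b hb => ?_) fun a b ha hb => ?_
  · rw [map_mul, pow _ (by rintro _ ⟨α, rfl⟩; exact involute_ofForm α) j a ha,
      pow _ (by rintro _ ⟨v, rfl⟩; exact involute_ofVec v) i b hb, smul_mul_smul_comm,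
      ← pow_add, add_comm]
  · rw [map_add, ha, hb, smul_add]

/-- Contraction kills the covector factor and removes one vector, so `-i + j` rises by one. -/
theorem contractLeft_mem_totalDegree (η : V →ₗ[ℂ] ℂ) {k : ℤ} {x : PVAlg V}
    (hx : x ∈ totalDegree V k) :
    contractLeft (η ∘ₗ LinearMap.snd ℂ (AntiDual V) V) x ∈ totalDegree V (k + 1) := by
  -- The claim uses the integer total degree, so `n = 0` needs no truncated `n - 1`.
  have vec (n : ℕ) : ∀ y ∈ LinearMap.range (ofVecₗ (V := V)) ^ n,
      contractLeft (η ∘ₗ LinearMap.snd ℂ (AntiDual V) V) y ∈ totalDegree V (-n + 1) := by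
    intro y hy
    induction hy using Submodule.pow_induction_on_left' with
    | algebraMap r => rw [CliffordAlgebra.contractLeft_algebraMap]; exact zero_mem _
    | add x y i _ _ hx hy => rw [map_add]; exact add_mem hx hy
    | mem_mul m hm i x hx' hx =>
      obtain ⟨v, rfl⟩ := hm
      rw [ofVecₗ_apply, contractLeft_mul, contractLeft_snd_ofVec, involute_ofVec, neg_mul,
        ← sub_eq_add_neg]
      refine sub_mem ?_ ?_
      · rw [← Algebra.smul_def]
        refine Submodule.smul_mem _ _ (bidegree_le_totalDegree (i := i) (j := 0) ?_ ?_)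
        · push_cast; ring
        · rwa [bidegree_eq, pow_zero, one_mul]
      · have := mul_mem_totalDegree (bidegree_le_totalDegree (k := -1) (by simp)
          (ofVec_mem_bidegree v)) hx
        convert this using 2
        push_cast; ring
  have form (n : ℕ) : ∀ y ∈ LinearMap.range (ofFormₗ (V := V)) ^ n,
      contractLeft (η ∘ₗ LinearMap.snd ℂ (AntiDual V) V) y = 0 := by
    intro y hy
    induction hy using Submodule.pow_induction_on_left' with
    | algebraMap r => rw [CliffordAlgebra.contractLeft_algebraMap]
    | add x y i _ _ hx hy => rw [map_add, hx, hy, add_zero]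
    | mem_mul m hm i x hx' hx =>
      obtain ⟨α, rfl⟩ := hm
      rw [ofFormₗ_apply, contractLeft_snd_ofForm_mul, hx, mul_zero, neg_zero]
  refine totalDegree_induction (C := fun x =>
    contractLeft (η ∘ₗ LinearMap.snd ℂ (AntiDual V) V) x ∈ totalDegree V (k + 1))
    (fun i j h x hx => ?_) ?_ ?_ hx
  · refine Submodule.mul_induction_on hx (fun a ha b hb => ?_) fun a b ha hb => ?_
    · have ha' : a ∈ bidegree V 0 j := by rwa [bidegree_eq, pow_zero, mul_one]
      rw [contractLeft_mul, form j a ha, zero_mul, zero_add, involute_of_mem_bidegree ha',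
        smul_mul_assoc]
      refine Submodule.smul_mem _ _ ?_
      have := mul_mem_totalDegree (bidegree_le_totalDegree (k := j) (by simp) ha') (vec i b hb)
      convert this using 2
      rw [← h]; ring
    · rw [map_add]; exact add_mem ha hb
  · rw [map_zero]; exact zero_mem _
  · intro a b ha hb; rw [map_add]; exact add_mem ha hb

/-- The vector factor is the image of `⋀^i V`, which vanishes above the dimension. Hence the
nilpotency of `∂̄s`. -/
theorem bidegree_eq_bot [Module.Finite ℂ V] {i : ℕ} (hi : Module.finrank ℂ V < i) (j : ℕ) :
    bidegree V i j = ⊥ := by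
  have h0 : (⋀[ℂ]^i V) = ⊥ := by
    rw [← Submodule.finrank_eq_zero (R := ℂ), exteriorPower.finrank_eq, Nat.choose_eq_zero_of_lt hi]
  have : LinearMap.range (ofVecₗ (V := V)) ^ i = ⊥ := by
    have : LinearMap.range (ofVecₗ (V := V)) = Submodule.map
        (ExteriorAlgebra.map (LinearMap.inr ℂ (AntiDual V) V)).toLinearMap
        (LinearMap.range (ExteriorAlgebra.ι ℂ)) := by
      rw [← LinearMap.range_comp]
      congr 1
      ext v
      simp [ofVecₗ]
    rw [this, ← Submodule.map_pow]
    change Submodule.map _ (⋀[ℂ]^i V) = ⊥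
    rw [h0, Submodule.map_bot]
  rw [bidegree_eq, this, Submodule.mul_bot]

end Fibre

/-! ### Wirtinger calculus on the model space -/

section Wirtinger

variable {d : ℕ} {E F G : Type*} [NormedAddCommGroup E] [NormedSpace ℂ E]
  [NormedAddCommGroup F] [NormedSpace ℂ F] [NormedAddCommGroup G] [NormedSpace ℂ G]

/-- The conjugate-linear part of a real-linear map. -/
def antiPart (L : Model d →L[ℝ] E) : Model d →ₗ⋆[ℂ] E where
  toFun w := (1 / 2 : ℂ) • (L w + Complex.I • L (Complex.I • w))
  map_add' v w := by simp only [smul_add, map_add]; abel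
  map_smul' c w := by
    have h (v : Model d) : L (c • v) = (c.re : ℂ) • L v + (c.im : ℂ) • L (Complex.I • v) := by
      have : c • v = c.re • v + c.im • (Complex.I • v) := by
        conv_lhs => rw [← Complex.re_add_im c]
        rw [add_smul, mul_smul]
        rfl
      rw [this, map_add, map_smul, map_smul]
      rfl
    have hc : starRingEnd ℂ c = (c.re : ℂ) - c.im * Complex.I := by
      apply Complex.ext <;> simp
    rw [h, smul_comm Complex.I c w, h, smul_smul Complex.I Complex.I w, Complex.I_mul_I, neg_smul,
      one_smul, map_neg, hc]
    have hI : Complex.I * Complex.I = -1 := Complex.I_mul_I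
    match_scalars
    · ring
    · linear_combination ((c.im : ℂ) / 2) * hI

/-- `∂f / ∂z̄_r` for maps to any complex normed space. -/
def pbar (r : Fin d) (f : Model d → E) (p : Model d) : E :=
  antiPart (fderiv ℝ f p) (EuclideanSpace.single r 1)

theorem antiPart_apply (L : Model d →L[ℝ] E) (w : Model d) :
    antiPart L w = (1 / 2 : ℂ) • (L w + Complex.I • L (Complex.I • w)) := rfl

theorem I_smul_single (r : Fin d) : Complex.I • (EuclideanSpace.single r 1 : Model d) =
    EuclideanSpace.single r Complex.I := by
  ext s
  simp

theorem partialBar_eq_pbar (r : Fin d) (f : Model d → PVAlg (Model d)) :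
    partialBar r f = pbar r f := by
  funext p
  rw [pbar, antiPart_apply, I_smul_single]
  rfl

theorem pbar_congr {r : Fin d} {f g : Model d → E} {p : Model d} (h : f =ᶠ[𝓝 p] g) :
    pbar r f p = pbar r g p := by
  rw [pbar, pbar, h.fderiv_eq]

theorem antiPart_add (L M : Model d →L[ℝ] E) (w : Model d) :
    antiPart (L + M) w = antiPart L w + antiPart M w := by
  simp only [antiPart_apply, add_apply, smul_add]
  abel

theorem pbar_add {r : Fin d} {f g : Model d → E} {p : Model d} (hf : DifferentiableAt ℝ f p)
    (hg : DifferentiableAt ℝ g p) :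
    pbar r (fun q => f q + g q) p = pbar r f p + pbar r g p := by
  rw [pbar, fderiv_fun_add hf hg, antiPart_add, pbar, pbar]

theorem pbar_const (r : Fin d) (c : E) (p : Model d) : pbar r (fun _ => c) p = 0 := by
  rw [pbar, fderiv_const_apply, antiPart_apply]
  simp

theorem pbar_sum {ι : Type*} {r : Fin d} {f : ι → Model d → E} {p : Model d} (s : Finset ι)
    (hf : ∀ i ∈ s, DifferentiableAt ℝ (f i) p) :
    pbar r (fun q => ∑ i ∈ s, f i q) p = ∑ i ∈ s, pbar r (f i) p := by
  classical
  induction s using Finset.induction_on with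
  | empty => simpa using pbar_const r (0 : E) p
  | insert i s hi ih =>
    simp only [Finset.sum_insert hi]
    rw [pbar_add (hf i (Finset.mem_insert_self i s))
      (DifferentiableAt.fun_sum fun j hj => hf j (Finset.mem_insert_of_mem hj)),
      ih fun j hj => hf j (Finset.mem_insert_of_mem hj)]

/-- Restriction of scalars of a bilinear map to `ℝ`. -/
def realBilin (B : E →L[ℂ] F →L[ℂ] G) : E →L[ℝ] F →L[ℝ] G :=
  (ContinuousLinearMap.restrictScalarsL ℂ F G ℝ ℝ).comp (B.restrictScalars ℝ)

theorem pbar_bilin (B : E →L[ℂ] F →L[ℂ] G) {r : Fin d} {f : Model d → E} {g : Model d → F}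
    {p : Model d} (hf : DifferentiableAt ℝ f p) (hg : DifferentiableAt ℝ g p) :
    pbar r (fun q => B (f q) (g q)) p = B (pbar r f p) (g p) + B (f p) (pbar r g p) := by
  have h := (realBilin B).fderiv_of_bilinear hf hg
  change fderiv ℝ (fun q => B (f q) (g q)) p = _ at h
  rw [pbar, h, antiPart_add, pbar, pbar, add_comm]
  simp only [antiPart_apply, ContinuousLinearMap.precompR_apply, ContinuousLinearMap.precompL_apply,
    map_smul, map_add, FunLike.coe_add, FunLike.coe_smul,
    Pi.add_apply, Pi.smul_apply]
  rfl

theorem differentiableAt_bilin (B : E →L[ℂ] F →L[ℂ] G) {f : Model d → E} {g : Model d → F}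
    {p : Model d} (hf : DifferentiableAt ℝ f p) (hg : DifferentiableAt ℝ g p) :
    DifferentiableAt ℝ (fun q => B (f q) (g q)) p :=
  ((realBilin B).hasFDerivAt_of_bilinear hf.hasFDerivAt hg.hasFDerivAt).differentiableAt

theorem contDiffAt_bilin (B : E →L[ℂ] F →L[ℂ] G) {n : ℕ∞ω} {f : Model d → E} {g : Model d → F}
    {p : Model d} (hf : ContDiffAt ℝ n f p) (hg : ContDiffAt ℝ n g p) :
    ContDiffAt ℝ n (fun q => B (f q) (g q)) p :=
  (realBilin B).isBoundedBilinearMap.contDiff.contDiffAt.comp p (hf.prodMk hg)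

theorem pbar_clm (L : E →L[ℂ] F) {r : Fin d} {f : Model d → E} {p : Model d}
    (hf : DifferentiableAt ℝ f p) : pbar r (fun q => L (f q)) p = L (pbar r f p) := by
  have h : fderiv ℝ (fun q => L (f q)) p = (L.restrictScalars ℝ).comp (fderiv ℝ f p) :=
    ((L.restrictScalars ℝ).hasFDerivAt.comp p hf.hasFDerivAt).fderiv
  rw [pbar, h, pbar]
  simp [antiPart_apply]

/-- Cauchy–Riemann: the complex-linear derivative satisfies `L (I • w) = I • L w`, so the two terms
of `antiPart` cancel. -/
theorem pbar_eq_zero_of_differentiableAt {r : Fin d} {f : Model d → E} {p : Model d}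
    (hf : DifferentiableAt ℂ f p) : pbar r f p = 0 := by
  rw [pbar, hf.fderiv_restrictScalars ℝ, antiPart_apply]
  simp [smul_smul]

/-- A conjugate-linear functional as a continuous real-linear map. -/
def antiCLM (α : AntiDual (Model d)) : Model d →L[ℝ] ℂ :=
  LinearMap.toContinuousLinearMap
    { toFun := α
      map_add' := map_add α
      map_smul' := fun c v => by
        have : α ((c : ℂ) • v) = starRingEnd ℂ (c : ℂ) • α v := map_smulₛₗ α _ _
        rw [Complex.conj_ofReal] at this
        exact this }

theorem antiCLM_apply (α : AntiDual (Model d)) (v : Model d) : antiCLM α v = α v := rfl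

/-- For a conjugate-linear derivative the two terms of `antiPart` agree, which absorbs the factor `1
/ 2`. -/
theorem pbar_antilinear_comp (α : AntiDual (Model d)) {r : Fin d} {h : Model d → Model d}
    {p : Model d} (hh : DifferentiableAt ℂ h p) :
    pbar r (fun q => α (h q)) p = α (fderiv ℂ h p (EuclideanSpace.single r 1)) := by
  have : fderiv ℝ (fun q => α (h q)) p =
      (antiCLM α).comp ((fderiv ℂ h p).restrictScalars ℝ) :=
    ((antiCLM α).hasFDerivAt.comp p (hh.hasFDerivAt.restrictScalars ℝ)).fderiv
  rw [pbar, this, antiPart_apply]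
  simp only [ContinuousLinearMap.comp_apply, ContinuousLinearMap.coe_restrictScalars', antiCLM_apply,
    map_smul, map_smulₛₗ, Complex.conj_I, smul_eq_mul]
  linear_combination (-(1 / 2 : ℂ) * α (fderiv ℂ h p (EuclideanSpace.single r 1))) * Complex.I_mul_I

theorem eq_sum_single (v : Model d) : v = ∑ r, v r • (EuclideanSpace.single r (1 : ℂ) : Model d) := by
  ext s
  simp [Finset.sum_apply, Pi.single_apply]

/-- Precomposition with the complex-linear differential of `Ψ` commutes with taking the
conjugate-linear part, so only the conjugate Jacobian enters. -/
theorem pbar_comp {r : Fin d} {g : Model d → E} {Ψ : Model d → Model d} {p : Model d}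
    (hg : DifferentiableAt ℝ g (Ψ p)) (hΨ : DifferentiableAt ℂ Ψ p) :
    pbar r (fun q => g (Ψ q)) p =
      ∑ s, starRingEnd ℂ (fderiv ℂ Ψ p (EuclideanSpace.single r 1) s) • pbar s g (Ψ p) := by
  have : fderiv ℝ (fun q => g (Ψ q)) p =
      (fderiv ℝ g (Ψ p)).comp ((fderiv ℂ Ψ p).restrictScalars ℝ) :=
    (hg.hasFDerivAt.comp p (hΨ.hasFDerivAt.restrictScalars ℝ)).fderiv
  have h2 : pbar r (fun q => g (Ψ q)) p =
      antiPart (fderiv ℝ g (Ψ p)) (fderiv ℂ Ψ p (EuclideanSpace.single r 1)) := by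
    rw [pbar, this]
    simp [antiPart_apply]
  rw [h2]
  conv_lhs => rw [eq_sum_single (fderiv ℂ Ψ p (EuclideanSpace.single r 1)), map_sum]
  simp only [map_smulₛₗ]
  rfl

theorem contDiffAt_pbar {r : Fin d} {f : Model d → E} {p : Model d} {m n : ℕ∞ω}
    (hf : ContDiffAt ℝ n f p) (hmn : m + 1 ≤ n) : ContDiffAt ℝ m (pbar r f) p := by
  have h := hf.fderiv_right hmn
  have (v : Model d) : ContDiffAt ℝ m (fun q => fderiv ℝ f q v) p := h.clm_apply contDiffAt_const
  have h1 := contDiffAt_const (c := (1 / 2 : ℂ)) |>.smul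
    ((this (EuclideanSpace.single r 1)).add ((contDiffAt_const (c := Complex.I)).smul
      (this (Complex.I • EuclideanSpace.single r 1))))
  exact h1

theorem pbar_pbar_comm {r s : Fin d} {f : Model d → E} {p : Model d} (hf : ContDiffAt ℝ 2 f p) :
    pbar r (pbar s f) p = pbar s (pbar r f) p := by
  have hd : DifferentiableAt ℝ (fderiv ℝ f) p :=
    (hf.fderiv_right (m := 1) (by norm_num)).differentiableAt one_ne_zero
  have hsymm : IsSymmSndFDerivAt ℝ f p := hf.isSymmSndFDerivAt (by simp)
  have key (t : Fin d) (w : Model d) : fderiv ℝ (pbar t f) p w =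
      (1 / 2 : ℂ) • (fderiv ℝ (fderiv ℝ f) p w (EuclideanSpace.single t 1) +
        Complex.I • fderiv ℝ (fderiv ℝ f) p w (Complex.I • EuclideanSpace.single t 1)) := by
    have h0 (v : Model d) : HasFDerivAt (fun q => fderiv ℝ f q v)
        ((fderiv ℝ (fderiv ℝ f) p).flip v) p := by
      have := hd.hasFDerivAt.clm_apply (hasFDerivAt_const v p)
      refine this.congr_fderiv ?_
      ext w
      simp
    have h1 := ((h0 (EuclideanSpace.single t 1)).add
      ((h0 (Complex.I • EuclideanSpace.single t 1)).const_smul Complex.I)).const_smul (1 / 2 : ℂ)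
    have h2 : fderiv ℝ (pbar t f) p = _ := h1.fderiv
    rw [h2]
    rfl
  rw [pbar, pbar, antiPart_apply, antiPart_apply, key, key, key, key]
  simp only [hsymm.eq (EuclideanSpace.single r 1), hsymm.eq (Complex.I • EuclideanSpace.single r 1)]
  module

/-- Derivatives of a map with values in a subspace lie in the subspace. -/
theorem fderiv_mem_of_eventually_mem [FiniteDimensional ℂ E] (N : Submodule ℂ E) {f : Model d → E}
    {p : Model d} (hf : ∀ᶠ q in 𝓝 p, f q ∈ N) (v : Model d) : fderiv ℝ f p v ∈ N := by
  by_cases hd : DifferentiableAt ℝ f p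
  · obtain ⟨g, hg⟩ := LinearMap.exists_leftInverse_of_injective N.subtype N.ker_subtype
    let P : E →L[ℂ] E := LinearMap.toContinuousLinearMap (N.subtype ∘ₗ g)
    have hP : f =ᶠ[𝓝 p] fun q => P (f q) := hf.mono fun q hq => by
      have := congrArg (fun l => l ⟨f q, hq⟩) hg
      exact (congrArg Subtype.val this).symm
    have h : fderiv ℝ f p = (P.restrictScalars ℝ).comp (fderiv ℝ f p) := by
      conv_lhs => rw [hP.fderiv_eq]
      exact ((P.restrictScalars ℝ).hasFDerivAt.comp p hd.hasFDerivAt).fderiv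
    rw [h]
    exact (g (fderiv ℝ f p v)).2
  -- Here `fderiv` has its default value `0`, which lies in `N`.
  · rw [fderiv_zero_of_not_differentiableAt hd]
    exact zero_mem _

theorem pbar_mem [FiniteDimensional ℂ E] (N : Submodule ℂ E) {f : Model d → E}
    {p : Model d} (hf : ∀ᶠ q in 𝓝 p, f q ∈ N) (r : Fin d) : pbar r f p ∈ N :=
  N.smul_mem _ (N.add_mem (fderiv_mem_of_eventually_mem N hf _)
    (N.smul_mem _ (fderiv_mem_of_eventually_mem N hf _)))

end Wirtinger

/-! ### The Dolbeault operator on the model space -/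

section DbarModel

open CliffordAlgebra (contractLeft involute)

variable {d : ℕ}

instance finiteDimensional_pvAlg : FiniteDimensional ℂ (PVAlg (Model d)) :=
  Module.Finite.of_basis (pvBasis d)

/-- A linear map on the fibre as a continuous linear map. -/
def fibreCLM (L : PVAlg (Model d) →ₗ[ℂ] PVAlg (Model d)) : PVAlg (Model d) →L[ℂ] PVAlg (Model d) :=
  LinearMap.toContinuousLinearMap L

variable (d) in
/-- Multiplication as a continuous bilinear map. -/
def mulCLM : PVAlg (Model d) →L[ℂ] PVAlg (Model d) →L[ℂ] PVAlg (Model d) :=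
  LinearMap.toContinuousLinearMap
    (LinearMap.toContinuousLinearMap.toLinearMap ∘ₗ LinearMap.mul ℂ (PVAlg (Model d)))

variable (d) in
/-- Contraction of a covector with an element of the fibre as a continuous bilinear map. -/
def contractCLM : (Model d →L[ℂ] ℂ) →L[ℂ] PVAlg (Model d) →L[ℂ] PVAlg (Model d) :=
  LinearMap.toContinuousLinearMap
    { toFun := fun η => fibreCLM
        (contractLeft ((η : Model d →ₗ[ℂ] ℂ) ∘ₗ LinearMap.snd ℂ (AntiDual (Model d)) _))
      map_add' := fun η θ => by
        ext x
        change contractLeft (((η + θ : Model d →L[ℂ] ℂ) : Model d →ₗ[ℂ] ℂ) ∘ₗ _) x =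
          contractLeft _ x + contractLeft _ x
        rw [ContinuousLinearMap.toLinearMap_add, LinearMap.add_comp, map_add, LinearMap.add_apply]
      map_smul' := fun c η => by
        ext x
        change contractLeft (((c • η : Model d →L[ℂ] ℂ) : Model d →ₗ[ℂ] ℂ) ∘ₗ _) x =
          c • contractLeft _ x
        rw [ContinuousLinearMap.toLinearMap_smul, LinearMap.smul_comp, map_smul, LinearMap.smul_apply] }

theorem contractCLM_apply (η : Model d →L[ℂ] ℂ) (x : PVAlg (Model d)) : contractCLM d η x =
    contractLeft ((η : Model d →ₗ[ℂ] ℂ) ∘ₗ LinearMap.snd ℂ (AntiDual (Model d)) _) x := rfl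

variable {f g : Model d → PVAlg (Model d)} {p : Model d}

theorem differentiableAt_mul (hf : DifferentiableAt ℝ f p) (hg : DifferentiableAt ℝ g p) :
    DifferentiableAt ℝ (fun q => f q * g q) p := differentiableAt_bilin (mulCLM d) hf hg

theorem contDiffAt_mul {n : ℕ∞ω} (hf : ContDiffAt ℝ n f p) (hg : ContDiffAt ℝ n g p) :
    ContDiffAt ℝ n (fun q => f q * g q) p := contDiffAt_bilin (mulCLM d) hf hg

theorem dbarModel_eq (f : Model d → PVAlg (Model d)) :
    dbarModel f = fun p => ∑ r, ofForm (dzbar d r) * pbar r f p := by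
  funext p
  simp only [dbarModel, partialBar_eq_pbar]

theorem dbarModel_congr (h : f =ᶠ[𝓝 p] g) : dbarModel f p = dbarModel g p := by
  simp only [dbarModel_eq, pbar_congr h]

theorem contDiffAt_dbarModel {m n : ℕ∞ω} (hf : ContDiffAt ℝ n f p) (hmn : m + 1 ≤ n) :
    ContDiffAt ℝ m (dbarModel f) p := by
  rw [dbarModel_eq]
  exact ContDiffAt.sum fun r _ => contDiffAt_mul contDiffAt_const (contDiffAt_pbar hf hmn)

theorem dbarModel_add (hf : DifferentiableAt ℝ f p) (hg : DifferentiableAt ℝ g p) :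
    dbarModel (fun q => f q + g q) p = dbarModel f p + dbarModel g p := by
  simp only [dbarModel_eq, pbar_add hf hg, mul_add, Finset.sum_add_distrib]

theorem dbarModel_sum {ι : Type*} {f : ι → Model d → PVAlg (Model d)} (s : Finset ι)
    (hf : ∀ i ∈ s, DifferentiableAt ℝ (f i) p) :
    dbarModel (fun q => ∑ i ∈ s, f i q) p = ∑ i ∈ s, dbarModel (f i) p := by
  simp only [dbarModel_eq, pbar_sum s hf, Finset.mul_sum]
  exact Finset.sum_comm

theorem dbarModel_const (c : PVAlg (Model d)) (p : Model d) : dbarModel (fun _ => c) p = 0 := by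
  simp [dbarModel_eq, pbar_const]

theorem dbarModel_eq_zero_of_differentiableAt (hf : DifferentiableAt ℂ f p) :
    dbarModel f p = 0 := by
  simp [dbarModel_eq, pbar_eq_zero_of_differentiableAt hf]

theorem dbarModel_mul (hf : DifferentiableAt ℝ f p) (hg : DifferentiableAt ℝ g p) :
    dbarModel (fun q => f q * g q) p =
      dbarModel f p * g p + involute (f p) * dbarModel g p := by
  have h (r : Fin d) : pbar r (fun q => f q * g q) p = pbar r f p * g p + f p * pbar r g p :=
    pbar_bilin (mulCLM d) hf hg
  simp only [dbarModel_eq, h, mul_add, Finset.sum_add_distrib, Finset.sum_mul, Finset.mul_sum]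
  refine congrArg₂ _ (Finset.sum_congr rfl fun r _ => (mul_assoc _ _ _).symm)
    (Finset.sum_congr rfl fun r _ => ?_)
  rw [← mul_assoc, ofForm_mul_eq, mul_assoc]

/-- As `η` is holomorphic, `∂ / ∂z̄_r` only acts on `f`; the sign comes from contraction passing `d
z̄_r`. -/
theorem dbarModel_contract {η : Model d → Model d →L[ℂ] ℂ} (hη : DifferentiableAt ℂ η p)
    (hf : DifferentiableAt ℝ f p) :
    dbarModel (fun q => contractCLM d (η q) (f q)) p = -contractCLM d (η p) (dbarModel f p) := by
  have h (r : Fin d) : pbar r (fun q => contractCLM d (η q) (f q)) p =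
      contractCLM d (η p) (pbar r f p) := by
    rw [pbar_bilin (contractCLM d) (hη.restrictScalars ℝ) hf, pbar_eq_zero_of_differentiableAt hη,
      map_zero]
    exact zero_add _
  simp only [dbarModel_eq, h, map_sum, ← Finset.sum_neg_distrib]
  refine Finset.sum_congr rfl fun r _ => ?_
  rw [contractCLM_apply, contractCLM_apply, contractLeft_snd_ofForm_mul, neg_neg]

/-- Exchanging the indices changes the sign of `d z̄_r d z̄_s` but not the coefficient, so the sum
equals its negative. It gives both `∂̄² = 0` and the closedness of pulled-back covectors. -/
theorem sum_ofForm_mul_symm_eq_zero {c : Fin d → Fin d → PVAlg (Model d)}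
    (hc : ∀ r s, c r s = c s r) :
    ∑ r, ∑ s, ofForm (dzbar d r) * (ofForm (dzbar d s) * c r s) = 0 := by
  have h : ∑ r, ∑ s, ofForm (dzbar d r) * (ofForm (dzbar d s) * c r s) =
      -∑ r, ∑ s, ofForm (dzbar d r) * (ofForm (dzbar d s) * c r s) := by
    conv_lhs => rw [Finset.sum_comm]
    simp only [← Finset.sum_neg_distrib]
    refine Finset.sum_congr rfl fun r _ => Finset.sum_congr rfl fun s _ => ?_
    rw [← mul_assoc, ofForm_mul_ofForm_comm, hc s r, neg_mul, mul_assoc]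
  have h2 := eq_neg_iff_add_eq_zero.1 h
  rw [← two_smul ℂ] at h2
  exact (smul_eq_zero.1 h2).resolve_left two_ne_zero

theorem dbarModel_dbarModel (hf : ContDiffAt ℝ 2 f p) : dbarModel (dbarModel f) p = 0 := by
  have hd (s : Fin d) : DifferentiableAt ℝ (pbar s f) p :=
    (contDiffAt_pbar (m := 1) hf (by norm_num)).differentiableAt one_ne_zero
  have h (r : Fin d) : pbar r (dbarModel f) p =
      ∑ s, ofForm (dzbar d s) * pbar r (pbar s f) p := by
    rw [dbarModel_eq, pbar_sum _ fun s _ => differentiableAt_mul (differentiableAt_const _) (hd s)]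
    refine Finset.sum_congr rfl fun s _ => ?_
    exact pbar_clm (mulCLM d (ofForm (dzbar d s))) (hd s)
  rw [dbarModel_eq]
  simp only [h, Finset.mul_sum]
  exact sum_ofForm_mul_symm_eq_zero fun r s => pbar_pbar_comm hf

theorem dbarModel_mem_totalDegree {k : ℤ} (hf : ∀ᶠ q in 𝓝 p, f q ∈ totalDegree (Model d) k) :
    dbarModel f p ∈ totalDegree (Model d) (k + 1) := by
  rw [dbarModel_eq]
  refine Submodule.sum_mem _ fun r _ => ?_
  rw [add_comm]
  exact mul_mem_totalDegree (bidegree_le_totalDegree (by simp) (ofForm_mem_bidegree _))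
    (pbar_mem _ hf r)

theorem dbarModel_mem_bidegree {i j : ℕ} (hf : ∀ᶠ q in 𝓝 p, f q ∈ bidegree (Model d) i j) :
    dbarModel f p ∈ bidegree (Model d) i (j + 1) := by
  rw [dbarModel_eq]
  refine Submodule.sum_mem _ fun r _ => ?_
  have := mul_mem_bidegree (ofForm_mem_bidegree (dzbar d r)) (pbar_mem _ hf r)
  rwa [zero_add, add_comm 1 j] at this

theorem antiDual_eq_sum (α : AntiDual (Model d)) :
    α = ∑ t, α (EuclideanSpace.single t 1) • dzbar d t := by
  refine LinearMap.ext fun v => ?_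
  conv_lhs => rw [eq_sum_single v, map_sum]
  rw [LinearMap.sum_apply]
  refine Finset.sum_congr rfl fun t _ => ?_
  rw [map_smulₛₗ, LinearMap.smul_apply, smul_eq_mul, smul_eq_mul, mul_comm]
  rfl

theorem ofForm_eq_sum (α : AntiDual (Model d)) :
    ofForm α = ∑ t, α (EuclideanSpace.single t 1) • ofForm (dzbar d t) := by
  conv_lhs => rw [antiDual_eq_sum α, ← ofFormₗ_apply, map_sum]
  simp only [map_smul, ofFormₗ_apply]

/-- The constant sections are `∂̄`-closed after a holomorphic change of frame `(B⁻¹, B)` for which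
`B` is the differential of a holomorphic map. -/
theorem dbarModel_push_const {A B : Model d → Model d →L[ℂ] Model d}
    (hA : DifferentiableAt ℂ A p) (hB : DifferentiableAt ℂ B p)
    (hsymm : ∀ v w, fderiv ℂ B p v w = fderiv ℂ B p w v) (x : PVAlg (Model d)) :
    DifferentiableAt ℝ (fun q => push (A q : Model d →ₗ[ℂ] Model d) (B q) x) p ∧
      dbarModel (fun q => push (A q : Model d →ₗ[ℂ] Model d) (B q) x) p = 0 := by
  induction x using pvAlg_induction with
  | algebraMap r =>
    simp only [AlgHom.commutes]
    exact ⟨differentiableAt_const _, dbarModel_const _ _⟩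
  | form α =>
    have hBt (t : Fin d) : DifferentiableAt ℂ (fun q => B q (EuclideanSpace.single t 1)) p :=
      hB.clm_apply (differentiableAt_const _)
    have hα (t : Fin d) : DifferentiableAt ℝ (fun q => α (B q (EuclideanSpace.single t 1))) p :=
      (antiCLM α).differentiableAt.comp p ((hBt t).restrictScalars ℝ)
    have heq : (fun q => push (A q : Model d →ₗ[ℂ] Model d) (B q) (ofForm α)) =
        fun q => ∑ t, α (B q (EuclideanSpace.single t 1)) • ofForm (dzbar d t) := by
      funext q
      rw [push_ofForm, ofForm_eq_sum]
      rfl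
    have hd (t : Fin d) : DifferentiableAt ℝ
        (fun q => α (B q (EuclideanSpace.single t 1)) • ofForm (dzbar d t)) p :=
      (hα t).smul_const _
    rw [heq]
    refine ⟨DifferentiableAt.fun_sum fun t _ => hd t, ?_⟩
    have hp (r t : Fin d) : pbar r (fun q => α (B q (EuclideanSpace.single t 1)) •
        ofForm (dzbar d t)) p = ofForm (dzbar d t) * algebraMap ℂ _ (α (fderiv ℂ B p
          (EuclideanSpace.single r 1) (EuclideanSpace.single t 1))) := by
      refine (pbar_clm ((ContinuousLinearMap.id ℂ ℂ).smulRight (ofForm (dzbar d t))) (hα t)).trans ?_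
      rw [pbar_antilinear_comp α (hBt t)]
      have : fderiv ℂ (fun q => B q (EuclideanSpace.single t 1)) p (EuclideanSpace.single r 1) =
          fderiv ℂ B p (EuclideanSpace.single r 1) (EuclideanSpace.single t 1) := by
        rw [fderiv_clm_apply hB (differentiableAt_const _)]
        simp
      rw [this, ← Algebra.commutes, ← Algebra.smul_def]
      rfl
    rw [dbarModel_eq]
    simp only [pbar_sum _ fun t _ => hd t, hp, Finset.mul_sum]
    -- The coefficient is `α` of a derivative of `B`, symmetric in its two directions. Where `B` is
    -- itself a differential, this is the symmetry of second derivatives.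
    exact sum_ofForm_mul_symm_eq_zero fun r s => by rw [hsymm]
  | vec v =>
    have heq : (fun q => push (A q : Model d →ₗ[ℂ] Model d) (B q) (ofVec v)) =
        fun q => ofVec (A q v) := by
      funext q
      rw [push_ofVec]
      rfl
    -- Vectors transform by `A`, which depends holomorphically on the point, so no symmetry is
    -- needed here.
    have hd : DifferentiableAt ℂ (fun q => ofVec (A q v)) p :=
      (LinearMap.toContinuousLinearMap (ofVecₗ (V := Model d))).differentiableAt.comp p
        (hA.clm_apply (differentiableAt_const v))
    rw [heq]
    exact ⟨hd.restrictScalars ℝ, dbarModel_eq_zero_of_differentiableAt hd⟩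
  | mul a b ha hb =>
    simp only [map_mul]
    refine ⟨differentiableAt_mul ha.1 hb.1, ?_⟩
    rw [dbarModel_mul ha.1 hb.1, ha.2, hb.2, zero_mul, mul_zero, add_zero]
  | add a b ha hb =>
    simp only [map_add]
    refine ⟨ha.1.add hb.1, ?_⟩
    rw [dbarModel_add ha.1 hb.1, ha.2, hb.2, add_zero]

/-- The Dolbeault operator commutes with holomorphic coordinate changes. -/
theorem dbarModel_coordChange {A : Model d → Model d →L[ℂ] Model d} {Ψ : Model d → Model d}
    (hA : DifferentiableAt ℂ A p) (hΨ : ContDiffAt ℂ ω Ψ p) (hf : DifferentiableAt ℝ f (Ψ p))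
    (hg : g =ᶠ[𝓝 p] fun q => push (A q : Model d →ₗ[ℂ] Model d) (fderiv ℂ Ψ q) (f (Ψ q))) :
    dbarModel g p = push (A p : Model d →ₗ[ℂ] Model d) (fderiv ℂ Ψ p) (dbarModel f (Ψ p)) := by
  have hΨ1 : DifferentiableAt ℂ Ψ p := hΨ.differentiableAt (by simp)
  have hB : DifferentiableAt ℂ (fderiv ℂ Ψ) p :=
    (hΨ.fderiv_right (m := 1) le_top).differentiableAt one_ne_zero
  have hsymm : IsSymmSndFDerivAt ℂ Ψ p := hΨ.isSymmSndFDerivAt le_top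
  have hconst := dbarModel_push_const hA hB (fun v w => hsymm.eq v w)
  let c := fun S : Finset (Fin (Module.finrank ℂ (AntiDual (Model d) × Model d))) =>
    LinearMap.toContinuousLinearMap ((pvBasis d).coord S)
  -- Expanding `f` in a constant basis splits the claim by the Leibniz rule into scalar functions
  -- (`hscal`) and constant sections (`hconst`).
  have hexp (x : PVAlg (Model d)) : x = ∑ S, algebraMap ℂ _ (c S x) * pvBasis d S := by
    simp only [← Algebra.smul_def]
    exact ((pvBasis d).sum_repr x).symm
  have hcf (S) : DifferentiableAt ℝ (fun q => c S (f q)) (Ψ p) :=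
    ((c S).restrictScalars ℝ).differentiableAt.comp _ hf
  let am : ℂ →L[ℂ] PVAlg (Model d) :=
    LinearMap.toContinuousLinearMap (Algebra.linearMap ℂ (PVAlg (Model d)))
  have hac (S) : DifferentiableAt ℝ (fun q => algebraMap ℂ (PVAlg (Model d)) (c S (f q))) (Ψ p) :=
    (am.restrictScalars ℝ).differentiableAt.comp _ (hcf S)
  have hac' (S) : DifferentiableAt ℝ
      (fun q => algebraMap ℂ (PVAlg (Model d)) (c S (f (Ψ q)))) p :=
    (hac S).comp p (hΨ1.restrictScalars ℝ)
  -- The conjugate Jacobian in `pbar_comp` is exactly the matrix by which `push` acts on the `d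
  -- z̄_s`.
  have hscal (S) : dbarModel (fun q => algebraMap ℂ (PVAlg (Model d)) (c S (f (Ψ q)))) p =
      push (A p : Model d →ₗ[ℂ] Model d) (fderiv ℂ Ψ p)
        (dbarModel (fun q => algebraMap ℂ (PVAlg (Model d)) (c S (f q))) (Ψ p)) := by
    have h1 (r) : pbar r (fun q => algebraMap ℂ (PVAlg (Model d)) (c S (f (Ψ q)))) p =
        algebraMap ℂ _ (∑ s, starRingEnd ℂ (fderiv ℂ Ψ p (EuclideanSpace.single r 1) s) •
          pbar s (fun q => c S (f q)) (Ψ p)) := by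
      rw [← pbar_comp (hcf S) hΨ1]
      exact pbar_clm am ((hcf S).comp p (hΨ1.restrictScalars ℝ))
    have h2 (s) : pbar s (fun q => algebraMap ℂ (PVAlg (Model d)) (c S (f q))) (Ψ p) =
        algebraMap ℂ _ (pbar s (fun q => c S (f q)) (Ψ p)) := pbar_clm am (hcf S)
    rw [dbarModel_eq, dbarModel_eq]
    simp only [h1, h2, map_sum, map_mul, AlgHom.commutes, push_ofForm, Finset.mul_sum, smul_eq_mul]
    rw [Finset.sum_comm]
    refine Finset.sum_congr rfl fun s _ => ?_
    rw [ofForm_eq_sum, Finset.sum_mul]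
    refine Finset.sum_congr rfl fun r _ => ?_
    rw [← map_mul, ← Algebra.commutes, ← Algebra.smul_def, smul_mul_assoc, ← Algebra.commutes,
      ← Algebra.smul_def, smul_smul]
    rfl
  have hg' : g =ᶠ[𝓝 p] fun q => ∑ S, algebraMap ℂ _ (c S (f (Ψ q))) *
      push (A q : Model d →ₗ[ℂ] Model d) (fderiv ℂ Ψ q) (pvBasis d S) := hg.trans
    (Filter.Eventually.of_forall fun q => by
      change push _ _ (f (Ψ q)) = _
      conv_lhs => rw [hexp (f (Ψ q)), map_sum]
      simp only [map_mul, AlgHom.commutes])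
  have hf' : f = fun q => ∑ S, algebraMap ℂ _ (c S (f q)) * pvBasis d S := funext fun q => hexp _
  rw [dbarModel_congr hg', dbarModel_sum _ fun S _ => differentiableAt_mul (hac' S) (hconst _).1]
  conv_rhs => rw [hf', dbarModel_sum _ fun S _ => differentiableAt_mul (hac S)
    (differentiableAt_const _)]
  rw [map_sum]
  refine Finset.sum_congr rfl fun S _ => ?_
  rw [dbarModel_mul (hac' S) (hconst _).1, dbarModel_mul (hac S) (differentiableAt_const _),
    (hconst _).2, dbarModel_const, mul_zero, add_zero, add_zero, map_mul, hscal]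

end DbarModel

/-! ### Charts -/

section Charts

open CliffordAlgebra (contractLeft involute)

variable {d : ℕ} {X : Type*} [TopologicalSpace X] [ChartedSpace (Model d) X]

/-- Every `q` close to the image of `x` is itself the image of a point of `O`, by continuity of the
inverse chart. Germs of coordinate expressions can thus be compared at points of `X`. -/
theorem eventually_extChartAt_symm {O : Set X} (hO : IsOpen O) {x₀ x : X} (hxO : x ∈ O)
    (hx : x ∈ (extChartAt 𝓘(ℂ, Model d) x₀).source) {P : Model d → Prop}
    (h : ∀ y ∈ O, y ∈ (extChartAt 𝓘(ℂ, Model d) x₀).source →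
      P (extChartAt 𝓘(ℂ, Model d) x₀ y)) :
    ∀ᶠ q in 𝓝 (extChartAt 𝓘(ℂ, Model d) x₀ x), P q := by
  have ht := (isOpen_extChartAt_target (I := 𝓘(ℂ, Model d)) x₀).mem_nhds
    ((extChartAt 𝓘(ℂ, Model d) x₀).map_source hx)
  have hc : ContinuousAt (extChartAt 𝓘(ℂ, Model d) x₀).symm (extChartAt 𝓘(ℂ, Model d) x₀ x) :=
    continuousAt_extChartAt_symm' hx
  have hO' : O ∈ 𝓝 ((extChartAt 𝓘(ℂ, Model d) x₀).symm (extChartAt 𝓘(ℂ, Model d) x₀ x)) := by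
    rw [(extChartAt 𝓘(ℂ, Model d) x₀).left_inv hx]
    exact hO.mem_nhds hxO
  filter_upwards [ht, hc hO'] with q hq hqO
  have := h _ hqO ((extChartAt 𝓘(ℂ, Model d) x₀).map_target hq)
  rwa [(extChartAt 𝓘(ℂ, Model d) x₀).right_inv hq] at this

variable [IsManifold 𝓘(ℂ, Model d) ω X]

theorem toModel_apply {x₀ x : X} (hx : x ∈ (extChartAt 𝓘(ℂ, Model d) x₀).source) (v : TX d x) :
    toModel d x₀ x v = tangentCoordChange 𝓘(ℂ, Model d) x x₀ x v := by
  rw [extChartAt_source] at hx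
  exact congrArg (fun L : TX d x →L[ℂ] Model d => L v)
    (TangentBundle.continuousLinearMapAt_trivializationAt_eq_core (I := 𝓘(ℂ, Model d)) hx)

theorem ofModel_apply {x₀ x : X} (hx : x ∈ (extChartAt 𝓘(ℂ, Model d) x₀).source) (v : Model d) :
    ofModel d x₀ x v = tangentCoordChange 𝓘(ℂ, Model d) x₀ x x v := by
  rw [extChartAt_source] at hx
  exact congrArg (fun L : Model d →L[ℂ] TX d x => L v)
    (TangentBundle.symmL_trivializationAt_eq_core (I := 𝓘(ℂ, Model d)) hx)

theorem tangentCoordChange_eq_fderiv {x y z : X} : tangentCoordChange 𝓘(ℂ, Model d) x y z =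
    fderiv ℂ (extChartAt 𝓘(ℂ, Model d) y ∘ (extChartAt 𝓘(ℂ, Model d) x).symm)
      (extChartAt 𝓘(ℂ, Model d) x z) := by
  rw [tangentCoordChange_def, modelWithCornersSelf_coe, Set.range_id, fderivWithin_univ]

theorem toModel_ofModel_apply {x₀ x₁ x : X} (h₀ : x ∈ (extChartAt 𝓘(ℂ, Model d) x₀).source)
    (h₁ : x ∈ (extChartAt 𝓘(ℂ, Model d) x₁).source) (v : Model d) :
    toModel d x₁ x (ofModel d x₀ x v) = tangentCoordChange 𝓘(ℂ, Model d) x₀ x₁ x v :=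
  (toModel_apply h₁ _).trans
    ((congrArg (fun w : Model d => tangentCoordChange 𝓘(ℂ, Model d) x x₁ x w)
      (ofModel_apply h₀ v)).trans
      (tangentCoordChange_comp ⟨⟨h₀, mem_extChartAt_source x⟩, h₁⟩))

theorem toModel_comp_ofModel_eq_fderiv {x₀ x₁ x : X} (h₀ : x ∈ (extChartAt 𝓘(ℂ, Model d) x₀).source)
    (h₁ : x ∈ (extChartAt 𝓘(ℂ, Model d) x₁).source) :
    toModel d x₁ x ∘ₗ ofModel d x₀ x =
      (fderiv ℂ (extChartAt 𝓘(ℂ, Model d) x₁ ∘ (extChartAt 𝓘(ℂ, Model d) x₀).symm)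
        (extChartAt 𝓘(ℂ, Model d) x₀ x) : Model d →ₗ[ℂ] Model d) := by
  refine LinearMap.ext fun v => ?_
  rw [LinearMap.comp_apply, toModel_ofModel_apply h₀ h₁, tangentCoordChange_eq_fderiv]
  rfl

theorem toModel_comp_ofModel {x₀ x : X} (hx : x ∈ (extChartAt 𝓘(ℂ, Model d) x₀).source) :
    toModel d x₀ x ∘ₗ ofModel d x₀ x = LinearMap.id := by
  refine LinearMap.ext fun v => ?_
  rw [LinearMap.comp_apply, toModel_ofModel_apply hx hx]
  exact tangentCoordChange_self hx

theorem ofModel_comp_toModel {x₀ x : X} (hx : x ∈ (extChartAt 𝓘(ℂ, Model d) x₀).source) :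
    ofModel d x₀ x ∘ₗ toModel d x₀ x = LinearMap.id := by
  refine LinearMap.ext fun v => ?_
  refine (ofModel_apply hx _).trans
    ((congrArg (fun w : Model d => tangentCoordChange 𝓘(ℂ, Model d) x₀ x x w)
      (toModel_apply hx v)).trans ?_)
  exact (tangentCoordChange_comp ⟨⟨mem_extChartAt_source x, hx⟩, mem_extChartAt_source x⟩).trans
    (tangentCoordChange_self (mem_extChartAt_source x))

theorem contDiffAt_coordChange {x₀ x₁ x : X} (h₀ : x ∈ (extChartAt 𝓘(ℂ, Model d) x₀).source)
    (h₁ : x ∈ (extChartAt 𝓘(ℂ, Model d) x₁).source) :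
    ContDiffAt ℂ ω (extChartAt 𝓘(ℂ, Model d) x₁ ∘ (extChartAt 𝓘(ℂ, Model d) x₀).symm)
      (extChartAt 𝓘(ℂ, Model d) x₀ x) := by
  have h' : extChartAt 𝓘(ℂ, Model d) x₀ x ∈
      ((extChartAt 𝓘(ℂ, Model d) x₀).symm ≫ (extChartAt 𝓘(ℂ, Model d) x₁)).source := by
    rw [PartialEquiv.trans_source'', PartialEquiv.symm_symm, PartialEquiv.symm_target]
    exact Set.mem_image_of_mem _ ⟨h₀, h₁⟩
  have := contDiffWithinAt_ext_coord_change (I := 𝓘(ℂ, Model d)) (n := ω) x₁ x₀ h'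
  rwa [modelWithCornersSelf_coe, Set.range_id, contDiffWithinAt_univ] at this

theorem inChart_extChartAt {x₀ x : X} (hx : x ∈ (extChartAt 𝓘(ℂ, Model d) x₀).source)
    (σ : RoughSection d X) : inChart x₀ σ (extChartAt 𝓘(ℂ, Model d) x₀ x) =
      push (toModel d x₀ x) (ofModel d x₀ x) (σ x) := by
  simp only [inChart]
  rw [(extChartAt 𝓘(ℂ, Model d) x₀).left_inv hx]

theorem push_inChart {x₀ x : X} (hx : x ∈ (extChartAt 𝓘(ℂ, Model d) x₀).source)
    (σ : RoughSection d X) : push (ofModel d x₀ x) (toModel d x₀ x)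
      (inChart x₀ σ (extChartAt 𝓘(ℂ, Model d) x₀ x)) = σ x := by
  rw [inChart_extChartAt hx, push_push_cancel (ofModel_comp_toModel hx)]

/-- The Dolbeault operator can be computed in any chart. -/
theorem inChart_dbar {σ : RoughSection d X} {x₀ x : X}
    (hx : x ∈ (extChartAt 𝓘(ℂ, Model d) x₀).source)
    (hσ : DifferentiableAt ℝ (inChart x₀ σ) (extChartAt 𝓘(ℂ, Model d) x₀ x)) :
    inChart x₀ (dbar σ) (extChartAt 𝓘(ℂ, Model d) x₀ x) =
      dbarModel (inChart x₀ σ) (extChartAt 𝓘(ℂ, Model d) x₀ x) := by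
  have hxx := mem_extChartAt_source (I := 𝓘(ℂ, Model d)) x
  have hΨx : (extChartAt 𝓘(ℂ, Model d) x₀ ∘ (extChartAt 𝓘(ℂ, Model d) x).symm)
      (extChartAt 𝓘(ℂ, Model d) x x) = extChartAt 𝓘(ℂ, Model d) x₀ x := by
    rw [Function.comp_apply, (extChartAt 𝓘(ℂ, Model d) x).left_inv hxx]
  have hΨ := contDiffAt_coordChange hxx hx
  -- `Ψ` is the transition from the chart at `x`, in which `dbar` is defined, to the chart at `x₀`.
  -- The frame change `A` is the differential of the inverse transition, taken along `Ψ`.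
  have hA : DifferentiableAt ℂ (fun q => fderiv ℂ
      (extChartAt 𝓘(ℂ, Model d) x ∘ (extChartAt 𝓘(ℂ, Model d) x₀).symm)
      ((extChartAt 𝓘(ℂ, Model d) x₀ ∘ (extChartAt 𝓘(ℂ, Model d) x).symm) q))
      (extChartAt 𝓘(ℂ, Model d) x x) := by
    have h1 := ((contDiffAt_coordChange hx hxx).fderiv_right (m := 1) le_top).differentiableAt
      one_ne_zero
    rw [← hΨx] at h1
    exact h1.comp _ (hΨ.differentiableAt (by simp))
  rw [← hΨx] at hσ
  have key := dbarModel_coordChange (g := inChart x σ) hA hΨ hσ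
    (eventually_extChartAt_symm (isOpen_extChartAt_source (I := 𝓘(ℂ, Model d)) x₀) hx hxx fun y hy₀ hy => by
      beta_reduce
      rw [Function.comp_apply, (extChartAt 𝓘(ℂ, Model d) x).left_inv hy, inChart_extChartAt hy,
        inChart_extChartAt hy₀, ← toModel_comp_ofModel_eq_fderiv hy₀ hy, ← toModel_comp_ofModel_eq_fderiv hy hy₀, push_push,
        LinearMap.comp_assoc, ofModel_comp_toModel hy₀, LinearMap.comp_id, ← LinearMap.comp_assoc,
        ofModel_comp_toModel hy₀, LinearMap.id_comp])
  rw [inChart_extChartAt hx, dbar, key, push_push, hΨx, ← toModel_comp_ofModel_eq_fderiv hx hxx,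
    ← toModel_comp_ofModel_eq_fderiv hxx hx, push_push]
  have h1 : (toModel d x₀ x ∘ₗ ofModel d x x) ∘ₗ (toModel d x x ∘ₗ ofModel d x₀ x) =
      LinearMap.id := by
    rw [LinearMap.comp_assoc, ← LinearMap.comp_assoc (ofModel d x₀ x), ofModel_comp_toModel hxx,
      LinearMap.id_comp, toModel_comp_ofModel hx]
  rw [h1]
  exact push_id _

/-- `dHol` is the derivative in the chart at `x`; the chain rule carries it to any other chart. So
`∂W` has holomorphic coefficients in every chart. -/
theorem dHol_comp_ofModel {W : X → ℂ} (hW : ContMDiff 𝓘(ℂ, Model d) 𝓘(ℂ) ω W) {x₀ x : X}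
    (hx : x ∈ (extChartAt 𝓘(ℂ, Model d) x₀).source) :
    dHol W x ∘ₗ ofModel d x₀ x = (fderiv ℂ (W ∘ (extChartAt 𝓘(ℂ, Model d) x₀).symm)
      (extChartAt 𝓘(ℂ, Model d) x₀ x) : Model d →ₗ[ℂ] ℂ) := by
  have hxx := mem_extChartAt_source (I := 𝓘(ℂ, Model d)) x
  have hWx (x₀ : X) (hx : x ∈ (extChartAt 𝓘(ℂ, Model d) x₀).source) :
      DifferentiableAt ℂ (W ∘ (extChartAt 𝓘(ℂ, Model d) x₀).symm)
        (extChartAt 𝓘(ℂ, Model d) x₀ x) := by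
    have := ((hW.comp_contMDiffOn (contMDiffOn_extChartAt_symm x₀)).contDiffOn).contDiffAt
      ((isOpen_extChartAt_target (I := 𝓘(ℂ, Model d)) x₀).mem_nhds
        ((extChartAt 𝓘(ℂ, Model d) x₀).map_source hx))
    exact this.differentiableAt (by simp)
  have h1 : dHol (d := d) W x = (fderiv ℂ (W ∘ (extChartAt 𝓘(ℂ, Model d) x).symm)
      (extChartAt 𝓘(ℂ, Model d) x x) : Model d →ₗ[ℂ] ℂ) := by
    have hm : mfderiv 𝓘(ℂ, Model d) 𝓘(ℂ) W x = fderiv ℂ (W ∘ (extChartAt 𝓘(ℂ, Model d) x).symm)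
      (extChartAt 𝓘(ℂ, Model d) x x) := by
      have h2 : fderivWithin ℂ (writtenInExtChartAt 𝓘(ℂ, Model d) 𝓘(ℂ) x W)
          (Set.range 𝓘(ℂ, Model d)) (extChartAt 𝓘(ℂ, Model d) x x) =
          fderiv ℂ (W ∘ (extChartAt 𝓘(ℂ, Model d) x).symm) (extChartAt 𝓘(ℂ, Model d) x x) := by
        rw [modelWithCornersSelf_coe, Set.range_id, fderivWithin_univ]
        rfl
      exact ((hW x).mdifferentiableAt (by simp)).mfderiv.trans h2
    exact congrArg ContinuousLinearMap.toLinearMap hm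
  refine LinearMap.ext fun v => ?_
  rw [LinearMap.comp_apply, ofModel_apply hx, h1, tangentCoordChange_eq_fderiv]
  have hev : W ∘ (extChartAt 𝓘(ℂ, Model d) x₀).symm =ᶠ[𝓝 (extChartAt 𝓘(ℂ, Model d) x₀ x)]
      (W ∘ (extChartAt 𝓘(ℂ, Model d) x).symm) ∘
        (extChartAt 𝓘(ℂ, Model d) x ∘ (extChartAt 𝓘(ℂ, Model d) x₀).symm) :=
    eventually_extChartAt_symm (isOpen_extChartAt_source (I := 𝓘(ℂ, Model d)) x) hxx hx
      fun y hy hy₀ => by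
        simp only [Function.comp_apply]
        rw [(extChartAt 𝓘(ℂ, Model d) x₀).left_inv hy₀, (extChartAt 𝓘(ℂ, Model d) x).left_inv hy]
  have hΨx : (extChartAt 𝓘(ℂ, Model d) x ∘ (extChartAt 𝓘(ℂ, Model d) x₀).symm)
      (extChartAt 𝓘(ℂ, Model d) x₀ x) = extChartAt 𝓘(ℂ, Model d) x x := by
    rw [Function.comp_apply, (extChartAt 𝓘(ℂ, Model d) x₀).left_inv hx]
  have hWxx := hWx x hxx
  rw [hev.fderiv_eq, fderiv_comp _ (by rwa [hΨx])
    ((contDiffAt_coordChange hx hxx).differentiableAt (by simp)), hΨx]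
  rfl

end Charts

/-! ### Calculus of sections -/

section Sections

open CliffordAlgebra (contractLeft involute)

variable {d : ℕ} {X : Type*} [TopologicalSpace X] [ChartedSpace (Model d) X]

/-- The pointwise product of sections. -/
def mulSec (σ τ : RoughSection d X) : RoughSection d X := fun x => σ x * τ x

/-- A function as a section of bidegree `(0, 0)`. -/
def scalarSec (a : X → ℂ) : RoughSection d X := fun x => algebraMap ℂ (PVFiber d x) (a x)

theorem add_apply (σ τ : RoughSection d X) (x : X) : (σ + τ) x = σ x + τ x := rfl

theorem smul_apply (f : HolFun d X) (σ : RoughSection d X) (x : X) : (f • σ) x = f x • σ x := rfl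

theorem smul_eq_mulSec (f : HolFun d X) (σ : RoughSection d X) :
    f • σ = mulSec (scalarSec f) σ := funext fun x => Algebra.smul_def (f x) (σ x)

theorem iotaW_mulSec (W : X → ℂ) (σ τ : RoughSection d X) (x : X) :
    iotaW W (mulSec σ τ) x = iotaW W σ x * τ x + involute (σ x) * iotaW W τ x :=
  contractLeft_mul _ _ _

theorem iotaW_add (W : X → ℂ) (σ τ : RoughSection d X) :
    iotaW W (σ + τ) = iotaW W σ + iotaW W τ := funext fun _ => map_add _ _ _

theorem iotaW_scalarSec (W : X → ℂ) (a : X → ℂ) (x : X) :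
    iotaW W (scalarSec a : RoughSection d X) x = 0 :=
  CliffordAlgebra.contractLeft_algebraMap _ _ _

theorem iotaW_iotaW (W : X → ℂ) (σ : RoughSection d X) (x : X) : iotaW W (iotaW W σ) x = 0 :=
  CliffordAlgebra.contractLeft_contractLeft _ _

theorem iotaW_mem_totalDegree {k : ℤ} (W : X → ℂ) {σ : RoughSection d X}
    (h : ∀ y, σ y ∈ totalDegree (TX d y) k) (x : X) : iotaW W σ x ∈ totalDegree (TX d x) (k + 1) := by
  rw [iotaW, ← LinearMap.smul_comp]
  exact contractLeft_mem_totalDegree _ (h x)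

variable [IsManifold 𝓘(ℂ, Model d) ω X]

variable (d X) in
/-- The real manifold underlying a complex manifold. -/
theorem isManifold_real : IsManifold 𝓘(ℝ, Model d) ∞ X := by
  refine isManifold_of_contDiffOn _ _ _ fun e e' he he' => ?_
  have h := HasGroupoid.compatible (G := contDiffGroupoid ω 𝓘(ℂ, Model d)) he he'
  rw [contDiffGroupoid, mem_groupoid_of_pregroupoid] at h
  have h1 : ContDiffOn ℂ ω _ _ := h.1
  exact (h1.restrict_scalars ℝ).of_le le_top

/-- A section is smooth over `O` if its coordinate expressions are. -/
def SmoothOn (σ : RoughSection d X) (O : Set X) : Prop :=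
  ∀ x ∈ O, ∀ x₀, x ∈ (extChartAt 𝓘(ℂ, Model d) x₀).source →
    ContDiffAt ℝ ∞ (inChart x₀ σ) (extChartAt 𝓘(ℂ, Model d) x₀ x)

theorem isSmooth_iff {σ : RoughSection d X} : IsSmooth σ ↔ SmoothOn σ Set.univ := by
  refine ⟨fun h x _ x₀ hx => (h x₀).contDiffAt
    ((isOpen_extChartAt_target (I := 𝓘(ℂ, Model d)) x₀).mem_nhds
      ((extChartAt 𝓘(ℂ, Model d) x₀).map_source hx)), fun h x₀ p hp => ?_⟩
  have := h _ trivial x₀ ((extChartAt 𝓘(ℂ, Model d) x₀).map_target hp)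
  rw [(extChartAt 𝓘(ℂ, Model d) x₀).right_inv hp] at this
  exact this.contDiffWithinAt

theorem contDiffAt_inChart_of_eqOn {σ : RoughSection d X} {O : Set X} (hO : IsOpen O) {x₀ x : X}
    (hxO : x ∈ O) (hx : x ∈ (extChartAt 𝓘(ℂ, Model d) x₀).source) {g : Model d → PVAlg (Model d)}
    (hg : ContDiffAt ℝ ∞ g (extChartAt 𝓘(ℂ, Model d) x₀ x))
    (h : ∀ y ∈ O, y ∈ (extChartAt 𝓘(ℂ, Model d) x₀).source →
      inChart x₀ σ (extChartAt 𝓘(ℂ, Model d) x₀ y) = g (extChartAt 𝓘(ℂ, Model d) x₀ y)) :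
    ContDiffAt ℝ ∞ (inChart x₀ σ) (extChartAt 𝓘(ℂ, Model d) x₀ x) :=
  hg.congr_of_eventuallyEq (eventually_extChartAt_symm hO hxO hx h)

variable {σ τ : RoughSection d X} {O O' : Set X} {x : X}

theorem SmoothOn.mono (h : SmoothOn σ O) (hO : O' ⊆ O) : SmoothOn σ O' :=
  fun x hx => h x (hO hx)

theorem SmoothOn.union (h : SmoothOn σ O) (h' : SmoothOn σ O') : SmoothOn σ (O ∪ O') :=
  fun x hx => hx.elim (h x) (h' x)

theorem SmoothOn.differentiableAt (h : SmoothOn σ O) (hx : x ∈ O) {x₀ : X}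
    (hx₀ : x ∈ (extChartAt 𝓘(ℂ, Model d) x₀).source) :
    DifferentiableAt ℝ (inChart x₀ σ) (extChartAt 𝓘(ℂ, Model d) x₀ x) :=
  (h x hx x₀ hx₀).differentiableAt (by simp)

theorem inChart_eventuallyEq (hO : IsOpen O) (hxO : x ∈ O) (h : ∀ y ∈ O, σ y = τ y) {x₀ : X}
    (hx : x ∈ (extChartAt 𝓘(ℂ, Model d) x₀).source) :
    inChart x₀ σ =ᶠ[𝓝 (extChartAt 𝓘(ℂ, Model d) x₀ x)] inChart x₀ τ :=
  eventually_extChartAt_symm hO hxO hx fun y hy hy₀ => by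
    rw [inChart_extChartAt hy₀, inChart_extChartAt hy₀, h y hy]

theorem SmoothOn.congr (hO : IsOpen O) (hσ : SmoothOn σ O) (h : ∀ y ∈ O, τ y = σ y) :
    SmoothOn τ O := fun x hx x₀ hx₀ =>
  (hσ x hx x₀ hx₀).congr_of_eventuallyEq (inChart_eventuallyEq hO hx h hx₀)

theorem inChart_mulSec (x₀ : X) (σ τ : RoughSection d X) :
    inChart x₀ (mulSec σ τ) = fun p => inChart x₀ σ p * inChart x₀ τ p :=
  funext fun _ => map_mul (push _ _) _ _

theorem inChart_scalarSec (x₀ : X) (a : X → ℂ) :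
    inChart x₀ (scalarSec a : RoughSection d X) =
      fun p => algebraMap ℂ _ (a ((extChartAt 𝓘(ℂ, Model d) x₀).symm p)) :=
  funext fun _ => AlgHom.commutes (push _ _) _

theorem SmoothOn.add (hσ : SmoothOn σ O) (hτ : SmoothOn τ O) : SmoothOn (σ + τ) O :=
  fun x hx x₀ hx₀ => by
    rw [inChart_add]
    exact (hσ x hx x₀ hx₀).add (hτ x hx x₀ hx₀)

theorem SmoothOn.mul (hσ : SmoothOn σ O) (hτ : SmoothOn τ O) : SmoothOn (mulSec σ τ) O :=
  fun x hx x₀ hx₀ => by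
    rw [inChart_mulSec]
    exact contDiffAt_mul (hσ x hx x₀ hx₀) (hτ x hx x₀ hx₀)

/-- The inclusion of the scalars in the fibre, as a continuous linear map. -/
def scalarCLM (d : ℕ) : ℂ →L[ℂ] PVAlg (Model d) :=
  LinearMap.toContinuousLinearMap (Algebra.linearMap ℂ (PVAlg (Model d)))

theorem smoothOn_scalarSec {a : X → ℂ}
    (ha : ∀ x ∈ O, ∀ x₀, x ∈ (extChartAt 𝓘(ℂ, Model d) x₀).source →
      ContDiffAt ℝ ∞ (a ∘ (extChartAt 𝓘(ℂ, Model d) x₀).symm) (extChartAt 𝓘(ℂ, Model d) x₀ x)) :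
    SmoothOn (scalarSec a : RoughSection d X) O := fun x hx x₀ hx₀ => by
  rw [inChart_scalarSec]
  exact ((scalarCLM d).restrictScalars ℝ).contDiff.contDiffAt.comp _ (ha x hx x₀ hx₀)

theorem smoothOn_scalarSec_of_contMDiff {a : X → ℂ}
    (ha : ContMDiff 𝓘(ℝ, Model d) 𝓘(ℝ, ℂ) ∞ a) (O : Set X) :
    SmoothOn (scalarSec a : RoughSection d X) O := by
  have := isManifold_real d X
  refine smoothOn_scalarSec fun x _ x₀ hx₀ => ?_
  have h : ContDiffOn ℝ ∞ (a ∘ (extChartAt 𝓘(ℝ, Model d) x₀).symm)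
      (extChartAt 𝓘(ℝ, Model d) x₀).target :=
    (ha.comp_contMDiffOn (contMDiffOn_extChartAt_symm x₀)).contDiffOn
  exact h.contDiffAt ((isOpen_extChartAt_target (I := 𝓘(ℂ, Model d)) x₀).mem_nhds
    ((extChartAt 𝓘(ℂ, Model d) x₀).map_source hx₀))

theorem differentiableAt_holFun (f : HolFun d X) {x₀ : X}
    (hx₀ : x ∈ (extChartAt 𝓘(ℂ, Model d) x₀).source) :
    DifferentiableAt ℂ (f ∘ (extChartAt 𝓘(ℂ, Model d) x₀).symm)
      (extChartAt 𝓘(ℂ, Model d) x₀ x) := by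
  have h : ContDiffOn ℂ ω (f ∘ (extChartAt 𝓘(ℂ, Model d) x₀).symm)
      (extChartAt 𝓘(ℂ, Model d) x₀).target :=
    (f.contMDiff.comp_contMDiffOn (contMDiffOn_extChartAt_symm x₀)).contDiffOn
  exact (h.contDiffAt ((isOpen_extChartAt_target (I := 𝓘(ℂ, Model d)) x₀).mem_nhds
    ((extChartAt 𝓘(ℂ, Model d) x₀).map_source hx₀))).differentiableAt (by simp)

/-! #### The Dolbeault operator -/

theorem SmoothOn.dbar (hO : IsOpen O) (hσ : SmoothOn σ O) : SmoothOn (dbar σ) O :=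
  fun x hx x₀ hx₀ => contDiffAt_inChart_of_eqOn hO hx hx₀
    (contDiffAt_dbarModel (hσ x hx x₀ hx₀) (by simp))
    fun _ hy hy₀ => inChart_dbar hy₀ (hσ.differentiableAt hy hy₀)

theorem dbar_congr (hO : IsOpen O) (hxO : x ∈ O) (h : ∀ y ∈ O, σ y = τ y) :
    dbar σ x = dbar τ x := by
  rw [dbar, dbar, dbarModel_congr (inChart_eventuallyEq hO hxO h (mem_extChartAt_source x))]

theorem inChart_zero (x₀ : X) : inChart x₀ (0 : RoughSection d X) = fun _ => 0 :=
  funext fun _ => map_zero (push _ _)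

theorem dbar_zero : dbar (0 : RoughSection d X) = 0 := funext fun x => by
  rw [dbar, inChart_zero, dbarModel_const, map_zero]
  rfl

theorem dbar_eq_zero_of_eqOn (hO : IsOpen O) (hxO : x ∈ O) (h : ∀ y ∈ O, σ y = 0) :
    dbar σ x = 0 := by
  rw [dbar_congr (τ := 0) hO hxO h, dbar_zero]
  rfl

theorem dbar_add (hσ : SmoothOn σ O) (hτ : SmoothOn τ O) (hx : x ∈ O) :
    dbar (σ + τ) x = dbar σ x + dbar τ x := by
  have hxx := mem_extChartAt_source (I := 𝓘(ℂ, Model d)) x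
  rw [dbar, inChart_add]
  exact (congrArg _ (dbarModel_add (hσ.differentiableAt hx hxx)
    (hτ.differentiableAt hx hxx))).trans (map_add _ _ _)

theorem dbar_mulSec (hσ : SmoothOn σ O) (hτ : SmoothOn τ O) (hx : x ∈ O) :
    dbar (mulSec σ τ) x = dbar σ x * τ x + involute (σ x) * dbar τ x := by
  have hxx := mem_extChartAt_source (I := 𝓘(ℂ, Model d)) x
  rw [dbar, inChart_mulSec, dbarModel_mul (hσ.differentiableAt hx hxx)
    (hτ.differentiableAt hx hxx), map_add, map_mul, map_mul, push_involute, push_inChart hxx,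
    push_inChart hxx]
  rfl

theorem dbar_dbar (hO : IsOpen O) (hσ : SmoothOn σ O) (hx : x ∈ O) : dbar (dbar σ) x = 0 := by
  have hxx := mem_extChartAt_source (I := 𝓘(ℂ, Model d)) x
  -- At a nearby `y` the inner `dbar` is defined by the chart at `y`; `inChart_dbar` moves it to the
  -- fixed chart at `x`.
  have h : inChart x (dbar σ) =ᶠ[𝓝 (extChartAt 𝓘(ℂ, Model d) x x)] dbarModel (inChart x σ) :=
    eventually_extChartAt_symm hO hx hxx fun y hy hy₀ =>
      inChart_dbar hy₀ (hσ.differentiableAt hy hy₀)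
  rw [dbar, dbarModel_congr h, dbarModel_dbarModel ((hσ x hx x hxx).of_le (WithTop.coe_le_coe.2 (le_top : (2 : ℕ∞) ≤ ⊤))),
    map_zero]

theorem dbar_scalarSec_holFun (f : HolFun d X) (x : X) :
    dbar (scalarSec f : RoughSection d X) x = 0 := by
  have hxx := mem_extChartAt_source (I := 𝓘(ℂ, Model d)) x
  rw [dbar, inChart_scalarSec, dbarModel_eq_zero_of_differentiableAt, map_zero]
  exact (scalarCLM d).differentiableAt.comp _ (differentiableAt_holFun f hxx)

theorem smoothOn_holFun (f : HolFun d X) (O : Set X) :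
    SmoothOn (scalarSec f : RoughSection d X) O :=
  smoothOn_scalarSec fun x _ x₀ hx₀ => by
    have h : ContDiffOn ℂ ω (f ∘ (extChartAt 𝓘(ℂ, Model d) x₀).symm)
        (extChartAt 𝓘(ℂ, Model d) x₀).target :=
      (f.contMDiff.comp_contMDiffOn (contMDiffOn_extChartAt_symm x₀)).contDiffOn
    exact (((h.restrict_scalars ℝ).of_le le_top).contDiffAt
      ((isOpen_extChartAt_target (I := 𝓘(ℂ, Model d)) x₀).mem_nhds
        ((extChartAt 𝓘(ℂ, Model d) x₀).map_source hx₀)))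

/-- `O(X)`-linearity is the Leibniz rule with `∂̄f = 0`. -/
theorem dbar_smul (f : HolFun d X) (hσ : SmoothOn σ Set.univ) :
    dbar (f • σ) = f • dbar σ := funext fun x => by
  rw [smul_eq_mulSec, dbar_mulSec (smoothOn_holFun f _) hσ trivial, dbar_scalarSec_holFun,
    zero_mul, zero_add, smul_apply, Algebra.smul_def]
  congr 1
  exact AlgHom.commutes _ _

theorem dbar_mem_totalDegree {k : ℤ} (h : ∀ y, σ y ∈ totalDegree (TX d y) k) (x : X) :
    dbar σ x ∈ totalDegree (TX d x) (k + 1) :=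
  push_mem_totalDegree _ _ (dbarModel_mem_totalDegree
    (Filter.Eventually.of_forall fun _ => push_mem_totalDegree _ _ (h _)))

/-- It will be applied to `sField` at all points, `Z_W` included: where the coordinate expression is
not differentiable, the default derivative `0` keeps the statement true. -/
theorem dbar_mem_bidegree {i j : ℕ} (h : ∀ y, σ y ∈ bidegree (TX d y) i j) (x : X) :
    dbar σ x ∈ bidegree (TX d x) i (j + 1) :=
  push_mem_bidegree _ _ (dbarModel_mem_bidegree
    (Filter.Eventually.of_forall fun _ => push_mem_bidegree _ _ (h _)))

/-! #### The contraction with `∂W` and the twisted differential -/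

variable {W : X → ℂ}

/-- The coordinate expression of `-i ∂W`. -/
def iotaCovector (W : X → ℂ) (x₀ : X) (q : Model d) : Model d →L[ℂ] ℂ :=
  (-Complex.I) • fderiv ℂ (W ∘ (extChartAt 𝓘(ℂ, Model d) x₀).symm) q

theorem inChart_iotaW (hW : ContMDiff 𝓘(ℂ, Model d) 𝓘(ℂ) ω W) {x₀ : X}
    (hx : x ∈ (extChartAt 𝓘(ℂ, Model d) x₀).source) :
    inChart x₀ (iotaW W σ) (extChartAt 𝓘(ℂ, Model d) x₀ x) =
      contractCLM d (iotaCovector W x₀ (extChartAt 𝓘(ℂ, Model d) x₀ x))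
        (inChart x₀ σ (extChartAt 𝓘(ℂ, Model d) x₀ x)) := by
  rw [inChart_extChartAt hx, inChart_extChartAt hx, iotaW, contractCLM_apply, ← LinearMap.smul_comp,
    push_contractLeft (ofModel_comp_toModel hx), LinearMap.smul_comp, dHol_comp_ofModel hW hx]
  rfl

theorem contDiffAt_dChart (hW : ContMDiff 𝓘(ℂ, Model d) 𝓘(ℂ) ω W) {x₀ : X}
    (hx : x ∈ (extChartAt 𝓘(ℂ, Model d) x₀).source) :
    ContDiffAt ℂ ω (fderiv ℂ (W ∘ (extChartAt 𝓘(ℂ, Model d) x₀).symm))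
      (extChartAt 𝓘(ℂ, Model d) x₀ x) := by
  have h : ContDiffAt ℂ ω (W ∘ (extChartAt 𝓘(ℂ, Model d) x₀).symm)
      (extChartAt 𝓘(ℂ, Model d) x₀ x) :=
    ((hW.comp_contMDiffOn (contMDiffOn_extChartAt_symm x₀)).contDiffOn).contDiffAt
      ((isOpen_extChartAt_target (I := 𝓘(ℂ, Model d)) x₀).mem_nhds
        ((extChartAt 𝓘(ℂ, Model d) x₀).map_source hx))
  exact h.fderiv_right (m := ω) le_top

theorem contDiffAt_iotaCovector (hW : ContMDiff 𝓘(ℂ, Model d) 𝓘(ℂ) ω W) {x₀ : X}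
    (hx : x ∈ (extChartAt 𝓘(ℂ, Model d) x₀).source) :
    ContDiffAt ℂ ω (iotaCovector W x₀) (extChartAt 𝓘(ℂ, Model d) x₀ x) :=
  (contDiffAt_dChart hW hx).const_smul (-Complex.I)

theorem SmoothOn.iotaW (hW : ContMDiff 𝓘(ℂ, Model d) 𝓘(ℂ) ω W) (hO : IsOpen O)
    (hσ : SmoothOn σ O) : SmoothOn (iotaW W σ) O := fun x hx x₀ hx₀ =>
  contDiffAt_inChart_of_eqOn hO hx hx₀
    (contDiffAt_bilin (contractCLM d)
      (((contDiffAt_iotaCovector hW hx₀).restrict_scalars ℝ).of_le le_top) (hσ x hx x₀ hx₀))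
    fun _ _ hy₀ => inChart_iotaW hW hy₀

/-- Holomorphy of `∂W` enters here; with `∂̄² = 0` and `ι_W² = 0` it gives `δ_W² = 0`. -/
theorem dbar_iotaW (hW : ContMDiff 𝓘(ℂ, Model d) 𝓘(ℂ) ω W) (hO : IsOpen O)
    (hσ : SmoothOn σ O) (hx : x ∈ O) : dbar (iotaW W σ) x = -iotaW W (dbar σ) x := by
  have hxx := mem_extChartAt_source (I := 𝓘(ℂ, Model d)) x
  have h : inChart x (iotaW W σ) =ᶠ[𝓝 (extChartAt 𝓘(ℂ, Model d) x x)]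
      fun q => contractCLM d (iotaCovector W x q) (inChart x σ q) :=
    eventually_extChartAt_symm hO hx hxx fun y _ hy₀ => inChart_iotaW hW hy₀
  rw [← push_inChart hxx (dbar (iotaW W σ)), inChart_dbar hxx
    ((hσ.iotaW hW hO).differentiableAt hx hxx), dbarModel_congr h,
    dbarModel_contract ((contDiffAt_iotaCovector hW hxx).differentiableAt (by simp))
      (hσ.differentiableAt hx hxx), ← inChart_dbar hxx (hσ.differentiableAt hx hxx),
    ← inChart_iotaW hW hxx, map_neg, push_inChart hxx]

theorem SmoothOn.twistedDiff (hW : ContMDiff 𝓘(ℂ, Model d) 𝓘(ℂ) ω W) (hO : IsOpen O)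
    (hσ : SmoothOn σ O) : SmoothOn (twistedDiff W σ) O := (hσ.dbar hO).add (hσ.iotaW hW hO)

theorem twistedDiff_apply (W : X → ℂ) (σ : RoughSection d X) (x : X) :
    twistedDiff W σ x = dbar σ x + iotaW W σ x := rfl

theorem twistedDiff_mulSec (hσ : SmoothOn σ O) (hτ : SmoothOn τ O) (hx : x ∈ O) :
    twistedDiff W (mulSec σ τ) x =
      twistedDiff W σ x * τ x + involute (σ x) * twistedDiff W τ x := by
  rw [twistedDiff_apply, dbar_mulSec hσ hτ hx, iotaW_mulSec, twistedDiff_apply, twistedDiff_apply,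
    add_mul, mul_add]
  abel

theorem twistedDiff_add (hσ : SmoothOn σ O) (hτ : SmoothOn τ O) (hx : x ∈ O) :
    twistedDiff W (σ + τ) x = twistedDiff W σ x + twistedDiff W τ x := by
  rw [twistedDiff_apply, dbar_add hσ hτ hx, iotaW_add, add_apply, twistedDiff_apply,
    twistedDiff_apply]
  abel

theorem twistedDiff_congr (hO : IsOpen O) (hxO : x ∈ O) (h : ∀ y ∈ O, σ y = τ y) :
    twistedDiff W σ x = twistedDiff W τ x := by
  rw [twistedDiff_apply, twistedDiff_apply, dbar_congr hO hxO h, iotaW, iotaW, h x hxO]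

theorem twistedDiff_twistedDiff (hW : ContMDiff 𝓘(ℂ, Model d) 𝓘(ℂ) ω W) (hO : IsOpen O)
    (hσ : SmoothOn σ O) (hx : x ∈ O) : twistedDiff W (twistedDiff W σ) x = 0 := by
  have h1 : iotaW W (twistedDiff W σ) = iotaW W (dbar σ) + iotaW W (iotaW W σ) := iotaW_add _ _ _
  rw [twistedDiff_apply, h1, add_apply, iotaW_iotaW, twistedDiff,
    dbar_add (hσ.dbar hO) (hσ.iotaW hW hO) hx, dbar_dbar hO hσ hx, dbar_iotaW hW hO hσ hx]
  abel

theorem twistedDiff_smul (f : HolFun d X) (hσ : SmoothOn σ Set.univ) :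
    twistedDiff W (f • σ) = f • twistedDiff W σ := funext fun x => by
  have : iotaW W (f • σ) = f • iotaW W σ := funext fun x => map_smul _ (f x) (σ x)
  rw [twistedDiff_apply, dbar_smul f hσ, this, twistedDiff, smul_add]
  rfl

theorem twistedDiff_mem_totalDegree {k : ℤ} (h : ∀ y, σ y ∈ totalDegree (TX d y) k) (x : X) :
    twistedDiff W σ x ∈ totalDegree (TX d x) (k + 1) :=
  add_mem (dbar_mem_totalDegree h x) (iotaW_mem_totalDegree W h x)

end Sections

/-! ### The gradient vector field -/

section Gradient

open CliffordAlgebra (contractLeft involute)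

theorem contDiffAt_det {E ι : Type*} [NormedAddCommGroup E] [NormedSpace ℝ E] [Fintype ι]
    [DecidableEq ι] {n : ℕ∞ω} {M : E → Matrix ι ι ℂ} {p : E}
    (hM : ∀ i j, ContDiffAt ℝ n (fun q => M q i j) p) :
    ContDiffAt ℝ n (fun q => (M q).det) p := by
  simp only [Matrix.det_apply]
  exact ContDiffAt.sum fun τ _ => (contDiffAt_prod fun i _ => hM _ _).const_smul _

variable {d : ℕ} {X : Type*} [TopologicalSpace X] [ChartedSpace (Model d) X]
  [IsManifold 𝓘(ℂ, Model d) ω X] (G : HermitianMetric d X) {W : X → ℂ}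

theorem HermitianMetric.eq_zero_of_self {x : X} {u : TX d x} (h : G.h x u u = 0) : u = 0 := by
  by_contra hu
  have := G.pos x u hu
  rw [h] at this
  exact lt_irrefl _ this

theorem HermitianMetric.ext_left {x : X} {u v : TX d x} (h : ∀ w, G.h x u w = G.h x v w) :
    u = v := by
  refine sub_eq_zero.1 (G.eq_zero_of_self ?_)
  rw [map_sub (G.h x) u v, LinearMap.sub_apply, h, sub_self]

/-- The Gram matrix of the coordinate vector fields of the chart at `x₀`. -/
def gramMatrix (x₀ : X) (p : Model d) : Matrix (Fin d) (Fin d) ℂ := fun i j =>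
  let x := (extChartAt 𝓘(ℂ, Model d) x₀).symm p
  G.h x (ofModel d x₀ x (EuclideanSpace.single j 1)) (ofModel d x₀ x (EuclideanSpace.single i 1))

/-- The conjugates of the partial derivatives of `W` in the chart at `x₀`. -/
def conjPartial (W : X → ℂ) (x₀ : X) (p : Model d) (i : Fin d) : ℂ :=
  starRingEnd ℂ (fderiv ℂ (W ∘ (extChartAt 𝓘(ℂ, Model d) x₀).symm) p (EuclideanSpace.single i 1))

/-- The coordinates of the gradient of `W̄` in the chart at `x₀`. -/
def gradCoord (W : X → ℂ) (x₀ : X) (p : Model d) : Model d :=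
  WithLp.toLp 2 fun i => (gramMatrix G x₀ p).det⁻¹ *
    (gramMatrix G x₀ p).cramer (conjPartial W x₀ p) i

theorem gramMatrix_mulVec {x₀ x : X} (hx : x ∈ (extChartAt 𝓘(ℂ, Model d) x₀).source)
    (c : Model d) (i : Fin d) :
    (gramMatrix G x₀ (extChartAt 𝓘(ℂ, Model d) x₀ x)).mulVec c i =
      G.h x (ofModel d x₀ x c) (ofModel d x₀ x (EuclideanSpace.single i 1)) := by
  conv_rhs => rw [eq_sum_single c, map_sum, map_sum]
  rw [Matrix.mulVec, dotProduct, LinearMap.sum_apply]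
  refine Finset.sum_congr rfl fun j _ => ?_
  rw [map_smul, map_smul, LinearMap.smul_apply, smul_eq_mul, mul_comm]
  simp only [gramMatrix]
  rw [(extChartAt 𝓘(ℂ, Model d) x₀).left_inv hx]

theorem ofModel_toModel {x₀ x : X} (hx : x ∈ (extChartAt 𝓘(ℂ, Model d) x₀).source) (v : TX d x) :
    ofModel d x₀ x (toModel d x₀ x v) = v :=
  congrArg (fun f => f v) (ofModel_comp_toModel hx)

theorem toModel_ofModel {x₀ x : X} (hx : x ∈ (extChartAt 𝓘(ℂ, Model d) x₀).source) (v : Model d) :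
    toModel d x₀ x (ofModel d x₀ x v) = v :=
  congrArg (fun f => f v) (toModel_comp_ofModel hx)

/-- Conjugate-linear functionals agree if they agree on the coordinate vectors. -/
theorem antiDual_ext {x₀ x : X} (hx : x ∈ (extChartAt 𝓘(ℂ, Model d) x₀).source)
    {α β : AntiDual (TX d x)} (h : ∀ i, α (ofModel d x₀ x (EuclideanSpace.single i 1)) =
      β (ofModel d x₀ x (EuclideanSpace.single i 1))) : α = β := by
  refine LinearMap.ext fun v => ?_
  rw [← ofModel_toModel hx v, eq_sum_single (toModel d x₀ x v)]
  simp only [map_sum, map_smul, map_smulₛₗ]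
  exact Finset.sum_congr rfl fun i _ => by rw [h i]

/-- A kernel vector of the Gram matrix is orthogonal to every tangent vector, itself included, so
positivity makes it zero. -/
theorem gramMatrix_det_ne_zero {x₀ x : X} (hx : x ∈ (extChartAt 𝓘(ℂ, Model d) x₀).source) :
    (gramMatrix G x₀ (extChartAt 𝓘(ℂ, Model d) x₀ x)).det ≠ 0 := by
  intro h
  obtain ⟨c, hc0, hc⟩ := Matrix.exists_mulVec_eq_zero_iff.2 h
  refine hc0 ?_
  have h1 : G.h x (ofModel d x₀ x (WithLp.toLp 2 c)) = 0 :=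
    antiDual_ext hx fun i => (gramMatrix_mulVec G hx (WithLp.toLp 2 c) i).symm.trans (congrFun hc i)
  have h2 : ofModel d x₀ x (WithLp.toLp 2 c) = 0 := G.eq_zero_of_self (by rw [h1]; rfl)
  have h3 : WithLp.toLp 2 c = (0 : Model d) := by
    rw [← toModel_ofModel hx (WithLp.toLp 2 c), h2, map_zero]
  exact congrArg WithLp.ofLp h3

/-- The conjugate of `∂W`. -/
def conjDHol (W : X → ℂ) (x : X) : AntiDual (TX d x) where
  toFun v := starRingEnd ℂ (dHol W x v)
  map_add' v w := by rw [map_add, map_add]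
  map_smul' c v := by rw [map_smul, smul_eq_mul, map_mul]; rfl

/-- `gradCoord` solves the Gram system by Cramer's rule. Written this way, the solution is a
polynomial in smooth entries over a nonvanishing determinant, hence visibly smooth. -/
theorem h_gradCoord (hW : ContMDiff 𝓘(ℂ, Model d) 𝓘(ℂ) ω W) {x₀ x : X}
    (hx : x ∈ (extChartAt 𝓘(ℂ, Model d) x₀).source) (v : TX d x) :
    G.h x (ofModel d x₀ x (gradCoord G W x₀ (extChartAt 𝓘(ℂ, Model d) x₀ x))) v =
      starRingEnd ℂ (dHol W x v) := by
  suffices h : G.h x (ofModel d x₀ x (gradCoord G W x₀ (extChartAt 𝓘(ℂ, Model d) x₀ x))) =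
      conjDHol W x from congrArg (fun f => f v) h
  refine antiDual_ext hx fun i => ?_
  rw [← gramMatrix_mulVec G hx]
  have h1 : (gradCoord G W x₀ (extChartAt 𝓘(ℂ, Model d) x₀ x)).ofLp =
      (gramMatrix G x₀ (extChartAt 𝓘(ℂ, Model d) x₀ x)).det⁻¹ •
        (gramMatrix G x₀ (extChartAt 𝓘(ℂ, Model d) x₀ x)).cramer
          (conjPartial W x₀ (extChartAt 𝓘(ℂ, Model d) x₀ x)) := rfl
  rw [h1, Matrix.mulVec_smul, Matrix.mulVec_cramer, inv_smul_smul₀ (gramMatrix_det_ne_zero G hx)]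
  exact congrArg (starRingEnd ℂ)
    (congrArg (fun f => f (EuclideanSpace.single i 1)) (dHol_comp_ofModel hW hx)).symm

theorem h_gradBar (hW : ContMDiff 𝓘(ℂ, Model d) 𝓘(ℂ) ω W) (x : X) (v : TX d x) :
    G.h x (gradBar G W x) v = starRingEnd ℂ (dHol W x v) :=
  Classical.epsilon_spec (p := fun g => ∀ v, G.h x g v = starRingEnd ℂ (dHol W x v))
    ⟨_, h_gradCoord G hW (mem_extChartAt_source x)⟩ v

/-- Nondegeneracy of the metric makes the vector chosen by `Classical.epsilon` unique, so Cramer's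
formula computes it in every chart. -/
theorem gradBar_eq (hW : ContMDiff 𝓘(ℂ, Model d) 𝓘(ℂ) ω W) {x₀ x : X}
    (hx : x ∈ (extChartAt 𝓘(ℂ, Model d) x₀).source) :
    gradBar G W x = ofModel d x₀ x (gradCoord G W x₀ (extChartAt 𝓘(ℂ, Model d) x₀ x)) :=
  G.ext_left fun w => (h_gradBar G hW x w).trans (h_gradCoord G hW hx w).symm

theorem dHol_gradBar (hW : ContMDiff 𝓘(ℂ, Model d) 𝓘(ℂ) ω W) (x : X) :
    dHol W x (gradBar G W x) = normSqdHol G W x := by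
  rw [normSqdHol, G.conj_symm, h_gradBar G hW, Complex.conj_conj]

theorem normSqdHol_ne_zero (hW : ContMDiff 𝓘(ℂ, Model d) 𝓘(ℂ) ω W) {x : X}
    (hx : x ∉ criticalSet d W) : normSqdHol G W x ≠ 0 := by
  intro h
  refine hx (LinearMap.ext fun v => ?_)
  have h1 := h_gradBar G hW x v
  rw [G.eq_zero_of_self h, map_zero, LinearMap.zero_apply] at h1
  exact (map_eq_zero _).1 h1.symm

theorem contDiffAt_gradCoord (hW : ContMDiff 𝓘(ℂ, Model d) 𝓘(ℂ) ω W) {x₀ x : X}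
    (hx : x ∈ (extChartAt 𝓘(ℂ, Model d) x₀).source) :
    ContDiffAt ℝ ∞ (gradCoord G W x₀) (extChartAt 𝓘(ℂ, Model d) x₀ x) := by
  have hM (i j : Fin d) : ContDiffAt ℝ ∞ (fun q => gramMatrix G x₀ q i j)
      (extChartAt 𝓘(ℂ, Model d) x₀ x) :=
    (G.smooth x₀ _ _).contDiffAt ((isOpen_extChartAt_target (I := 𝓘(ℂ, Model d)) x₀).mem_nhds
      ((extChartAt 𝓘(ℂ, Model d) x₀).map_source hx))
  have hb (i : Fin d) : ContDiffAt ℝ ∞ (fun q => conjPartial W x₀ q i)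
      (extChartAt 𝓘(ℂ, Model d) x₀ x) := by
    have h := ((contDiffAt_dChart hW hx).restrict_scalars ℝ).of_le (le_top : ∞ ≤ ω)
    exact Complex.conjCLE.contDiff.contDiffAt.comp _
      (contDiffAt_bilin (ContinuousLinearMap.id ℂ (Model d →L[ℂ] ℂ)) h
        (contDiffAt_const (c := EuclideanSpace.single i (1 : ℂ))))
  refine contDiffAt_piLp' 2 fun i => ?_
  refine ((contDiffAt_det hM).inv (gramMatrix_det_ne_zero G hx)).mul ?_
  simp only [Matrix.cramer_apply]
  refine contDiffAt_det fun k l => ?_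
  by_cases hl : l = i
  · subst hl
    simpa using hb k
  · simpa [Matrix.updateCol_apply, hl] using hM k l

theorem smoothOn_sField (hW : ContMDiff 𝓘(ℂ, Model d) 𝓘(ℂ) ω W)
    (hO : IsOpen (criticalSet d W)ᶜ) : SmoothOn (sField G W) (criticalSet d W)ᶜ := by
  intro x hx x₀ hx₀
  -- The squared norm is written as `∂W (grad W̄)`, a pairing of two smooth coordinate expressions.
  let N : Model d → ℂ := fun q =>
    fderiv ℂ (W ∘ (extChartAt 𝓘(ℂ, Model d) x₀).symm) q (gradCoord G W x₀ q)
  have hN {y : X} (hy : y ∈ (extChartAt 𝓘(ℂ, Model d) x₀).source) :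
      N (extChartAt 𝓘(ℂ, Model d) x₀ y) = normSqdHol G W y := by
    rw [← dHol_gradBar G hW, gradBar_eq G hW hy]
    exact (congrArg (fun f => f (gradCoord G W x₀ (extChartAt 𝓘(ℂ, Model d) x₀ y)))
      (dHol_comp_ofModel hW hy)).symm
  have hNs : ContDiffAt ℝ ∞ N (extChartAt 𝓘(ℂ, Model d) x₀ x) :=
    contDiffAt_bilin (ContinuousLinearMap.id ℂ (Model d →L[ℂ] ℂ))
      (((contDiffAt_dChart hW hx₀).restrict_scalars ℝ).of_le le_top)
      (contDiffAt_gradCoord G hW hx₀)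
  let vec : Model d →L[ℂ] PVAlg (Model d) := LinearMap.toContinuousLinearMap ofVecₗ
  have hg : ContDiffAt ℝ ∞ (fun q => (Complex.I * (N q)⁻¹) • vec (gradCoord G W x₀ q))
      (extChartAt 𝓘(ℂ, Model d) x₀ x) := by
    refine (contDiffAt_const.mul (hNs.inv ?_)).smul
      ((vec.restrictScalars ℝ).contDiff.contDiffAt.comp _ (contDiffAt_gradCoord G hW hx₀))
    rw [hN hx₀]
    exact normSqdHol_ne_zero G hW hx
  refine contDiffAt_inChart_of_eqOn hO hx hx₀ hg fun y hy hy₀ => ?_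
  rw [inChart_extChartAt hy₀, sField, push_ofVec, map_smul, gradBar_eq G hW hy₀,
    toModel_ofModel hy₀, hN hy₀, div_eq_mul_inv]
  exact map_smul (ofVecₗ (V := Model d)) _ _

/-- The factor `-i` of `ι_W` meets the factor `i` of `s`, and `∂W (grad W̄)` cancels the norm. -/
theorem iotaW_sField (hW : ContMDiff 𝓘(ℂ, Model d) 𝓘(ℂ) ω W) {x : X}
    (hx : x ∉ criticalSet d W) : iotaW W (sField G W) x = 1 := by
  rw [iotaW, sField, ← LinearMap.smul_comp, contractLeft_snd_ofVec, LinearMap.smul_apply,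
    map_smul (dHol W x), dHol_gradBar G hW, smul_eq_mul, smul_eq_mul, div_mul_cancel₀ _ (normSqdHol_ne_zero G hW hx),
    neg_mul, Complex.I_mul_I, neg_neg, map_one]

end Gradient

/-! ### The homotopy identity -/

section HomotopyIdentity

open CliffordAlgebra (contractLeft involute)

variable {d : ℕ} {X : Type*} [TopologicalSpace X] [ChartedSpace (Model d) X]
  [IsManifold 𝓘(ℂ, Model d) ω X] {G : HermitianMetric d X} {W ρ : X → ℂ}
  {σ τ : RoughSection d X} {O : Set X} {x : X}

theorem smoothOn_const (c : ℂ) (O : Set X) : SmoothOn (scalarSec fun _ => c : RoughSection d X) O :=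
  smoothOn_scalarSec fun _ _ _ _ => contDiffAt_const

theorem dbar_const (c : ℂ) (x : X) :
    dbar (scalarSec fun _ => c : RoughSection d X) x = 0 := by
  rw [dbar, inChart_scalarSec]
  exact (congrArg _ (dbarModel_const (algebraMap ℂ _ c) _)).trans (map_zero _)

/-- `RoughSection` is given no product here, so the power enters as a section `τ` with a pointwise
equation. -/
theorem SmoothOn.pow (hσ : SmoothOn σ O) (n : ℕ) (hτ : ∀ x, τ x = σ x ^ n) : SmoothOn τ O := by
  induction n generalizing τ with
  | zero =>
    have : τ = scalarSec fun _ => 1 :=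
      funext fun x => (hτ x).trans ((pow_zero (σ x)).trans (map_one _).symm)
    rw [this]
    exact smoothOn_const 1 O
  | succ n ih =>
    let υ : RoughSection d X := fun x => σ x ^ n
    have : τ = mulSec υ σ := funext fun x => (hτ x).trans (pow_succ (σ x) n)
    rw [this]
    exact (ih fun _ => rfl).mul hσ

theorem SmoothOn.neg (hσ : SmoothOn σ O) (hτ : ∀ x, τ x = -σ x) : SmoothOn τ O := by
  have : τ = mulSec (scalarSec fun _ => -1) σ := funext fun x => by
    rw [hτ, mulSec, scalarSec, map_neg, map_one, neg_one_mul]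
  rw [this]
  exact (smoothOn_const _ _).mul hσ

theorem smoothOn_sum {ι : Type*} (s : Finset ι) {f : ι → RoughSection d X}
    (hf : ∀ i ∈ s, SmoothOn (f i) O) (hτ : ∀ x, τ x = ∑ i ∈ s, f i x) : SmoothOn τ O := by
  classical
  induction s using Finset.induction_on generalizing τ with
  | empty =>
    have : τ = scalarSec fun _ => 0 :=
      funext fun x => (hτ x).trans (Finset.sum_empty.trans (map_zero _).symm)
    rw [this]
    exact smoothOn_const 0 O
  | insert i s hi ih =>
    let υ : RoughSection d X := fun x => ∑ j ∈ s, f j x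
    have : τ = f i + υ := funext fun x => (hτ x).trans (Finset.sum_insert hi)
    rw [this]
    exact (hf i (Finset.mem_insert_self i s)).add
      (ih (fun j hj => hf j (Finset.mem_insert_of_mem hj)) fun _ => rfl)

variable (G W) in
/-- The inverse `∑ (-1)^k (∂̄s)^k` of `1 + ∂̄s`. -/
def geomSec : RoughSection d X := fun x =>
  ∑ k ∈ Finset.range (d + 1), (-1) ^ k * (dbar (sField G W) x) ^ k

theorem geomSec_apply (x : X) : geomSec G W x =
    ∑ k ∈ Finset.range (d + 1), (-dbar (sField G W) x) ^ k :=
  Finset.sum_congr rfl fun _ _ => (neg_pow _ _).symm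

theorem dbar_sField_mem (x : X) : dbar (sField G W) x ∈ bidegree (TX d x) 1 1 :=
  dbar_mem_bidegree (fun _ => ofVec_mem_bidegree _) x

theorem involute_dbar_sField (x : X) :
    involute (dbar (sField G W) x) = dbar (sField G W) x := by
  rw [involute_of_mem_bidegree (dbar_sField_mem x)]
  norm_num

theorem involute_geomSec (x : X) : involute (geomSec G W x) = geomSec G W x := by
  simp only [geomSec_apply, map_sum, map_pow, map_neg, involute_dbar_sField]

/-- `s` is odd and the series in `∂̄s` is even. This oddness gives the sign in `δ_W (R σ) = σ - R
δ_W σ`. -/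
theorem involute_bigR (x : X) : involute (bigR G W x) = -bigR G W x := by
  change involute (sField G W x * geomSec G W x) = -(sField G W x * geomSec G W x)
  rw [map_mul, involute_geomSec, sField, involute_ofVec, neg_mul]

/-- The power contains `d + 1` vectors of a `d`-dimensional space. Hence the series stopped at `k =
d` is an exact two-sided inverse of `1 + ∂̄s`. -/
theorem neg_dbar_sField_pow_eq_zero (x : X) : (-dbar (sField G W) x) ^ (d + 1) = 0 := by
  have h : dbar (sField G W) x ^ (d + 1) ∈ bidegree (TX d x) ((d + 1) * 1) ((d + 1) * 1) :=
    pow_mem_bidegree (dbar_sField_mem x) _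
  have hfr : Module.finrank ℂ (TX d x) = d := finrank_euclideanSpace_fin (𝕜 := ℂ) (n := d)
  have : Module.Finite ℂ (TX d x) := inferInstanceAs (Module.Finite ℂ (Model d))
  rw [bidegree_eq_bot (by omega), Submodule.mem_bot] at h
  rw [neg_pow, h, mul_zero]

theorem one_add_mul_geomSec (x : X) : (dbar (sField G W) x + 1) * geomSec G W x = 1 := by
  have h := mul_neg_geom_sum (-dbar (sField G W) x) (d + 1)
  rwa [neg_dbar_sField_pow_eq_zero, sub_zero, sub_neg_eq_add, add_comm, ← geomSec_apply] at h

theorem geomSec_mul_one_add (x : X) : geomSec G W x * (dbar (sField G W) x + 1) = 1 := by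
  have h := geom_sum_mul_neg (-dbar (sField G W) x) (d + 1)
  rwa [neg_dbar_sField_pow_eq_zero, sub_zero, sub_neg_eq_add, ← geomSec_apply, add_comm] at h

theorem geomSec_mem_totalDegree (x : X) : geomSec G W x ∈ totalDegree (TX d x) 0 := by
  rw [geomSec_apply]
  refine Submodule.sum_mem _ fun k _ => ?_
  exact bidegree_le_totalDegree (by simp) (pow_mem_bidegree (neg_mem (dbar_sField_mem x)) k)

theorem bigR_mem_totalDegree (x : X) : bigR G W x ∈ totalDegree (TX d x) (-1) := by
  have := mul_mem_totalDegree (bidegree_le_totalDegree (k := -1) (by simp)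
    (ofVec_mem_bidegree ((Complex.I / normSqdHol G W x) • gradBar G W x)))
    (geomSec_mem_totalDegree (G := G) (W := W) x)
  rwa [add_zero] at this

theorem smoothOn_geomSec (hW : ContMDiff 𝓘(ℂ, Model d) 𝓘(ℂ) ω W)
    (hO : IsOpen (criticalSet d W)ᶜ) : SmoothOn (geomSec G W) (criticalSet d W)ᶜ := by
  let N : RoughSection d X := fun x => -dbar (sField G W) x
  have hN : SmoothOn N (criticalSet d W)ᶜ := ((smoothOn_sField G hW hO).dbar hO).neg fun _ => rfl
  exact smoothOn_sum (Finset.range (d + 1)) (f := fun k x => N x ^ k)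
    (fun k _ => hN.pow k fun _ => rfl) fun x => geomSec_apply x

theorem bigR_eq : bigR G W = mulSec (sField G W) (geomSec G W) := rfl

theorem smoothOn_bigR (hW : ContMDiff 𝓘(ℂ, Model d) 𝓘(ℂ) ω W)
    (hO : IsOpen (criticalSet d W)ᶜ) : SmoothOn (bigR G W) (criticalSet d W)ᶜ :=
  (smoothOn_sField G hW hO).mul (smoothOn_geomSec hW hO)

theorem twistedDiff_const (W : X → ℂ) (c : ℂ) (x : X) :
    twistedDiff W (scalarSec fun _ => c : RoughSection d X) x = 0 := by
  rw [twistedDiff_apply, dbar_const, iotaW_scalarSec, add_zero]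

theorem twistedDiff_sField (hW : ContMDiff 𝓘(ℂ, Model d) 𝓘(ℂ) ω W) (hx : x ∉ criticalSet d W) :
    twistedDiff W (sField G W) x = dbar (sField G W) x + 1 := by
  rw [twistedDiff_apply, iotaW_sField G hW hx]

/-- Apply `δ_W` to `(δ_W s) g = 1`: the term with `δ_W² s` drops out, and the even unit `1 + ∂̄s`
left in front of `δ_W g` is cancelled. -/
theorem twistedDiff_geomSec (hW : ContMDiff 𝓘(ℂ, Model d) 𝓘(ℂ) ω W)
    (hO : IsOpen (criticalSet d W)ᶜ) (hx : x ∉ criticalSet d W) :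
    twistedDiff W (geomSec G W) x = 0 := by
  have hs := smoothOn_sField G hW hO
  have h1 : twistedDiff W (mulSec (twistedDiff W (sField G W)) (geomSec G W)) x = 0 := by
    rw [twistedDiff_congr (τ := scalarSec fun _ => 1) hO hx fun y hy => ?_, twistedDiff_const]
    rw [mulSec, twistedDiff_sField hW hy, one_add_mul_geomSec]
    exact (map_one _).symm
  rw [twistedDiff_mulSec (hs.twistedDiff hW hO) (smoothOn_geomSec hW hO) hx,
    twistedDiff_twistedDiff hW hO hs hx, zero_mul, zero_add, twistedDiff_sField hW hx, map_add,
    map_one, involute_dbar_sField] at h1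
  rw [← one_mul (twistedDiff W (geomSec G W) x), ← geomSec_mul_one_add (G := G) (W := W) x,
    mul_assoc, h1, mul_zero]

theorem twistedDiff_bigR (hW : ContMDiff 𝓘(ℂ, Model d) 𝓘(ℂ) ω W)
    (hO : IsOpen (criticalSet d W)ᶜ) (hx : x ∉ criticalSet d W) :
    twistedDiff W (bigR G W) x = 1 := by
  rw [bigR_eq, twistedDiff_mulSec (smoothOn_sField G hW hO) (smoothOn_geomSec hW hO) hx,
    twistedDiff_geomSec hW hO hx, mul_zero, add_zero, twistedDiff_sField hW hx,
    one_add_mul_geomSec]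

theorem homotopyOp_eq (σ : RoughSection d X) : homotopyOp G W ρ σ =
    mulSec (scalarSec fun x => 1 - ρ x) (mulSec (bigR G W) σ) :=
  funext fun _ => Algebra.smul_def _ _

theorem inverseOp_apply (σ : RoughSection d X) (x : X) : inverseOp G W ρ σ x =
    ρ x • σ x + dbar (scalarSec ρ) x * (bigR G W x * σ x) := rfl

/-- `R` is controlled only off `Z_W`, but `1 - ρ` vanishes on an open `U ⊇ Z_W`; `U` and the
complement of `Z_W` cover `X`. -/
theorem smoothOn_homotopyOp (hW : ContMDiff 𝓘(ℂ, Model d) 𝓘(ℂ) ω W)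
    (hO : IsOpen (criticalSet d W)ᶜ) (hρ : IsCutoff (d := d) W ρ) (hσ : SmoothOn σ Set.univ) :
    SmoothOn (homotopyOp G W ρ σ) Set.univ := by
  obtain ⟨U, hU, hZU, hρU⟩ := hρ.eq_one
  have h1 : SmoothOn (homotopyOp G W ρ σ) (criticalSet d W)ᶜ := by
    rw [homotopyOp_eq]
    exact (smoothOn_scalarSec_of_contMDiff (contMDiff_const.sub hρ.smooth) _).mul
      ((smoothOn_bigR hW hO).mul (hσ.mono (Set.subset_univ _)))
  have h2 : SmoothOn (homotopyOp G W ρ σ) U :=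
    (smoothOn_const 0 U).congr hU fun y hy => by
      rw [homotopyOp, hρU y hy, sub_self, zero_smul]
      exact (map_zero _).symm
  exact (h1.union h2).mono fun x _ => by
    by_cases hx : x ∈ criticalSet d W
    · exact Or.inr (hZU hx)
    · exact Or.inl hx

/-- `δ_W 𝓡 + 𝓡 δ_W = 1 - π`. -/
theorem twistedDiff_homotopyOp (hW : ContMDiff 𝓘(ℂ, Model d) 𝓘(ℂ) ω W)
    (hO : IsOpen (criticalSet d W)ᶜ) (hρ : IsCutoff (d := d) W ρ) (hσ : SmoothOn σ Set.univ)
    (x : X) : twistedDiff W (homotopyOp G W ρ σ) x + homotopyOp G W ρ (twistedDiff W σ) x =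
      σ x - inverseOp G W ρ σ x := by
  obtain ⟨U, hU, hZU, hρU⟩ := hρ.eq_one
  by_cases hx : x ∈ criticalSet d W
  -- On `Z_W` both sides vanish: `ρ = 1` nearby, so `𝓡` is zero there, `∂̄ρ = 0` and `π σ = σ`.
  · have h1 : twistedDiff W (homotopyOp G W ρ σ) x = 0 := by
      rw [twistedDiff_congr (τ := scalarSec fun _ => 0) hU (hZU hx) fun y hy => ?_,
        twistedDiff_const]
      rw [homotopyOp, hρU y hy, sub_self, zero_smul]
      exact (map_zero _).symm
    have h2 : dbar (scalarSec ρ : RoughSection d X) x = 0 := by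
      rw [dbar_congr (τ := scalarSec fun _ => 1) hU (hZU hx) fun y hy => ?_, dbar_const]
      rw [scalarSec, scalarSec, hρU y hy]
    rw [h1, inverseOp_apply, h2, homotopyOp, hρU x (hZU hx), sub_self, zero_smul, zero_mul,
      one_smul, add_zero, add_zero, sub_self]
  · have hσ' := hσ.mono (Set.subset_univ (criticalSet d W)ᶜ)
    have ha := smoothOn_scalarSec_of_contMDiff (a := fun x => 1 - ρ x)
      (contMDiff_const.sub hρ.smooth) (criticalSet d W)ᶜ
    have hb := smoothOn_scalarSec_of_contMDiff hρ.smooth (criticalSet d W)ᶜ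
    have hR : SmoothOn (bigR G W) (criticalSet d W)ᶜ := smoothOn_bigR hW hO
    have hda : dbar (scalarSec fun x => 1 - ρ x : RoughSection d X) x =
        -dbar (scalarSec ρ : RoughSection d X) x := by
      have h := dbar_add ha hb hx
      rw [dbar_congr (τ := scalarSec fun _ => 1) hO hx fun y _ => ?_, dbar_const] at h
      · exact eq_neg_of_add_eq_zero_left h.symm
      · rw [add_apply, scalarSec, scalarSec, scalarSec, ← map_add, sub_add_cancel]
    have hRσ : twistedDiff W (mulSec (bigR G W) σ) x = σ x - bigR G W x * twistedDiff W σ x := by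
      rw [twistedDiff_mulSec hR hσ' hx, twistedDiff_bigR hW hO hx, involute_bigR, one_mul, neg_mul,
        sub_eq_add_neg]
    have hδ : twistedDiff W (scalarSec fun x => 1 - ρ x : RoughSection d X) x =
        -dbar (scalarSec ρ : RoughSection d X) x := by
      rw [twistedDiff_apply, hda, iotaW_scalarSec, add_zero]
    -- The Leibniz rule gives `-(∂̄ρ) R σ + (1 - ρ) (σ - R δ_W σ)`, whose last term cancels `𝓡 δ_W
    -- σ`.
    rw [homotopyOp_eq, twistedDiff_mulSec ha (hR.mul hσ') hx, hRσ, hδ, inverseOp_apply,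
      homotopyOp, mulSec, scalarSec, AlgHom.commutes, ← Algebra.smul_def, smul_sub, sub_smul,
      sub_smul, one_smul, one_smul, neg_mul]
    abel

theorem homotopyOp_mem_totalDegree {k l : ℤ} (hl : l + 1 = k)
    (h : ∀ y, σ y ∈ totalDegree (TX d y) k) (x : X) :
    homotopyOp G W ρ σ x ∈ totalDegree (TX d x) l := by
  have := mul_mem_totalDegree (bigR_mem_totalDegree (G := G) (W := W) x) (h x)
  rw [show -1 + k = l by omega] at this
  exact Submodule.smul_mem _ _ this

end HomotopyIdentity

/-! ### Existence of metrics and cutoff functions -/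

section Existence

/-- A connected, locally compact, paracompact Hausdorff space is `σ`-compact. -/
theorem sigmaCompactSpace_of_connected (X : Type*) [TopologicalSpace X] [T2Space X]
    [ParacompactSpace X] [ConnectedSpace X] [LocallyCompactSpace X] : SigmaCompactSpace X := by
  choose C hC hxC using fun x : X => exists_compact_mem_nhds x
  obtain ⟨V, hVo, hVc, hVf, hVC⟩ := precise_refinement (fun x => interior (C x))
    (fun x => isOpen_interior) (Set.iUnion_eq_univ_iff.2 fun x => ⟨x, mem_interior_iff_mem_nhds.2
      (hxC x)⟩)
  have hcl (a : X) : IsCompact (closure (V a)) :=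
    (hC a).of_isClosed_subset isClosed_closure
      (closure_minimal ((hVC a).trans interior_subset) (hC a).isClosed)
  obtain ⟨x₀⟩ : Nonempty X := inferInstance
  -- Each step adds the members of the locally finite cover that meet the previous compact set. Only
  -- finitely many do, so compactness persists.
  let K : ℕ → Set X := fun n => n.rec {x₀} fun _ S => ⋃ a ∈ {a | (V a ∩ S).Nonempty}, closure (V a)
  have hK (n : ℕ) : IsCompact (K n) := by
    induction n with
    | zero => exact isCompact_singleton
    | succ n ih =>
      exact (hVf.finite_nonempty_inter_compact ih).isCompact_biUnion fun a _ => hcl a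
  have hV {a : X} {n : ℕ} (h : (V a ∩ K n).Nonempty) : V a ⊆ K (n + 1) :=
    subset_closure.trans (Set.subset_biUnion_of_mem (u := fun a => closure (V a)) h)
  have hcov (x : X) : ∃ a, x ∈ V a := Set.mem_iUnion.1 (hVc ▸ Set.mem_univ x)
  have hopen : IsOpen (⋃ n, K n) := by
    refine isOpen_iff_mem_nhds.2 fun x hx => ?_
    obtain ⟨n, hn⟩ := Set.mem_iUnion.1 hx
    obtain ⟨a, ha⟩ := hcov x
    exact Filter.mem_of_superset ((hVo a).mem_nhds ha)
      ((hV ⟨x, ha, hn⟩).trans (Set.subset_iUnion K (n + 1)))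
  -- A member of the cover around a limit point meets some `K n`, so it lies in `K (n + 1)`. The
  -- union is clopen, and connectedness makes it everything.
  have hclosed : IsClosed (⋃ n, K n) := by
    refine isClosed_of_closure_subset fun x hx => ?_
    obtain ⟨a, ha⟩ := hcov x
    obtain ⟨y, hya, hy⟩ := mem_closure_iff.1 hx (V a) (hVo a) ha
    obtain ⟨n, hn⟩ := Set.mem_iUnion.1 hy
    exact Set.mem_iUnion.2 ⟨n + 1, hV ⟨y, hya, hn⟩ ha⟩
  have huniv : ⋃ n, K n = Set.univ := IsClopen.eq_univ ⟨hclosed, hopen⟩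
    ⟨x₀, Set.mem_iUnion.2 ⟨0, rfl⟩⟩
  exact SigmaCompactSpace_iff_exists_compact_covering.2 ⟨K, hK, huniv⟩

variable (d : ℕ) (X : Type*) [TopologicalSpace X] [T2Space X] [SigmaCompactSpace X]
  [ChartedSpace (Model d) X] [IsManifold 𝓘(ℂ, Model d) ω X]

theorem exists_isCutoff (W : X → ℂ) (hZ : IsCompact (criticalSet d W)) :
    ∃ ρ : X → ℂ, IsCutoff (d := d) W ρ := by
  have := isManifold_real d X
  have := ChartedSpace.locallyCompactSpace (Model d) X
  obtain ⟨K, hK, hZK⟩ := exists_compact_superset hZ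
  obtain ⟨f, hf0, hf1, -⟩ := exists_contMDiffMap_zero_one_nhds_of_isClosed 𝓘(ℝ, Model d) (n := ⊤)
    (isOpen_interior (s := K)).isClosed_compl hZ.isClosed
    (Set.disjoint_left.2 fun x hx hx' => hx (hZK hx'))
  refine ⟨fun x => (f x : ℂ), ?_, ?_, ?_⟩
  · exact Complex.ofRealCLM.contDiff.contMDiff.comp f.contMDiff
  · refine HasCompactSupport.intro hK fun x hx => ?_
    have := hf0.self_of_nhdsSet x fun h => hx (interior_subset h)
    simp [this]
  · obtain ⟨U, hU, hZU, hU1⟩ := mem_nhdsSet_iff_exists.1 hf1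
    exact ⟨U, hU, hZU, fun x hx => by simpa using hU1 hx⟩

/-- The pull-back of the standard Hermitian form by the trivialization at `x₀`. -/
def pullbackForm (x₀ x : X) : TX d x →ₗ[ℂ] TX d x →ₗ⋆[ℂ] ℂ :=
  LinearMap.mk₂'ₛₗ (RingHom.id ℂ) (starRingEnd ℂ)
    -- `inner ℂ` is conjugate-linear in its first argument, hence the exchange of `u` and `v`.
    (fun u v => inner ℂ (toModel d x₀ x v) (toModel d x₀ x u))
    (fun u v w => by rw [map_add, inner_add_right])
    (fun c u v => by rw [map_smul, inner_smul_right]; rfl)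
    (fun u v w => by rw [map_add, inner_add_left])
    (fun c u v => by rw [map_smul, inner_smul_left]; rfl)

theorem nonempty_hermitianMetric : Nonempty (HermitianMetric d X) := by
  have := isManifold_real d X
  obtain ⟨f, hf⟩ := SmoothPartitionOfUnity.exists_isSubordinate 𝓘(ℝ, Model d) (s := Set.univ)
    isClosed_univ (fun i : X => (extChartAt 𝓘(ℂ, Model d) i).source)
    (fun i => isOpen_extChartAt_source i)
    (fun x _ => Set.mem_iUnion.2 ⟨x, mem_extChartAt_source x⟩)
  -- A convex combination of local Hermitian forms. The weight `f i` is zero outside the chart at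
  -- `i`, so the values of `toModel` there do not matter.
  let H (x : X) : TX d x →ₗ[ℂ] TX d x →ₗ⋆[ℂ] ℂ :=
    ∑ i ∈ f.finsupport x, ((f i x : ℝ) : ℂ) • pullbackForm d X i x
  have hH (x : X) (u v : TX d x) : H x u v = ∑ i ∈ f.finsupport x,
      ((f i x : ℝ) : ℂ) * inner ℂ (toModel d i x v) (toModel d i x u) := by
    simp only [H, LinearMap.sum_apply]
    rfl
  refine ⟨⟨H, fun x u v => ?_, fun x u hu => ?_, fun x₀ u v => ?_⟩⟩
  · simp only [hH, map_sum, map_mul, Complex.conj_ofReal, inner_conj_symm]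
  · rw [hH, Complex.re_sum]
    have hterm (i : X) : (((f i x : ℝ) : ℂ) * inner ℂ (toModel d i x u) (toModel d i x u)).re =
        f i x * ‖toModel d i x u‖ ^ 2 := by
      rw [inner_self_eq_norm_sq_to_K, Complex.re_ofReal_mul]
      congr 1
      norm_cast
    simp only [hterm]
    obtain ⟨i, hi⟩ := f.exists_pos_of_mem (Set.mem_univ x)
    have hmem : i ∈ f.finsupport x := (f.mem_finsupport x).2 hi.ne'
    refine Finset.sum_pos' (fun j _ => mul_nonneg (f.nonneg j x) (sq_nonneg _)) ⟨i, hmem, ?_⟩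
    have hx : x ∈ (extChartAt 𝓘(ℂ, Model d) i).source := hf i (subset_tsupport _ hi.ne')
    refine mul_pos hi (pow_pos (norm_pos_iff.2 fun h => hu ?_) 2)
    rw [← ofModel_toModel hx u, h, map_zero]
  · intro p hp
    refine ContDiffAt.contDiffWithinAt ?_
    obtain ⟨x, hx, rfl⟩ : ∃ x, x ∈ (extChartAt 𝓘(ℂ, Model d) x₀).source ∧
        extChartAt 𝓘(ℂ, Model d) x₀ x = p :=
      ⟨_, (extChartAt 𝓘(ℂ, Model d) x₀).map_target hp, (extChartAt 𝓘(ℂ, Model d) x₀).right_inv hp⟩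
    obtain ⟨N, hN, hfin⟩ := f.locallyFinite x
    let I : Finset X := hfin.toFinset
    have hxN : x ∈ interior N := mem_interior_iff_mem_nhds.2 hN
    -- The index set `f.finsupport y` varies with `y`; near `x` it is replaced by the fixed finite
    -- set `I`, and the frames by differentials of transition maps.
    let term (i : X) (q : Model d) : ℂ := ((f i ((extChartAt 𝓘(ℂ, Model d) x₀).symm q) : ℝ) : ℂ) *
      inner ℂ (fderiv ℂ (extChartAt 𝓘(ℂ, Model d) i ∘ (extChartAt 𝓘(ℂ, Model d) x₀).symm) q v)
        (fderiv ℂ (extChartAt 𝓘(ℂ, Model d) i ∘ (extChartAt 𝓘(ℂ, Model d) x₀).symm) q u)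
    have hsum : ContDiffAt ℝ ∞ (fun q => ∑ i ∈ I, term i q) (extChartAt 𝓘(ℂ, Model d) x₀ x) := by
      refine ContDiffAt.sum fun i _ => ?_
      by_cases hxi : x ∈ (extChartAt 𝓘(ℂ, Model d) i).source
      · have h1 : ContDiffOn ℝ ∞ (f i ∘ (extChartAt 𝓘(ℝ, Model d) x₀).symm)
            (extChartAt 𝓘(ℝ, Model d) x₀).target :=
          ((f i).contMDiff.comp_contMDiffOn (contMDiffOn_extChartAt_symm x₀)).contDiffOn
        have h2 : ContDiffAt ℝ ∞ (f i ∘ (extChartAt 𝓘(ℂ, Model d) x₀).symm)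
            (extChartAt 𝓘(ℂ, Model d) x₀ x) :=
          h1.contDiffAt ((isOpen_extChartAt_target (I := 𝓘(ℂ, Model d)) x₀).mem_nhds hp)
        have h3 : ContDiffAt ℝ ∞ (fderiv ℂ
            (extChartAt 𝓘(ℂ, Model d) i ∘ (extChartAt 𝓘(ℂ, Model d) x₀).symm))
            (extChartAt 𝓘(ℂ, Model d) x₀ x) :=
          ((((contDiffAt_coordChange hx hxi).fderiv_right (m := ω) le_top)).restrict_scalars
            ℝ).of_le le_top
        have h4 (w : Model d) := contDiffAt_bilin
          (ContinuousLinearMap.id ℂ (Model d →L[ℂ] Model d)) h3 (contDiffAt_const (c := w))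
        exact (Complex.ofRealCLM.contDiff.contDiffAt.comp _ h2).mul ((h4 v).inner ℂ (h4 u))
      -- The transition map need not be smooth here, but the weight vanishes near `x`.
      · have hxi' : x ∈ (tsupport (f i))ᶜ := fun h => hxi (hf i h)
        refine (contDiffAt_const (c := (0 : ℂ))).congr_of_eventuallyEq ?_
        refine eventually_extChartAt_symm (isClosed_tsupport (f i)).isOpen_compl hxi' hx
          fun y hy hy₀ => ?_
        simp only [term]
        rw [(extChartAt 𝓘(ℂ, Model d) x₀).left_inv hy₀, image_eq_zero_of_notMem_tsupport hy,
          Complex.ofReal_zero, zero_mul]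
    refine hsum.congr_of_eventuallyEq (eventually_extChartAt_symm isOpen_interior hxN hx
      fun y hy hy₀ => ?_)
    beta_reduce
    simp only [term]
    rw [(extChartAt 𝓘(ℂ, Model d) x₀).left_inv hy₀, hH]
    have hsub : f.finsupport y ⊆ I := fun i hi => hfin.mem_toFinset.2
      ⟨y, (f.mem_finsupport y).1 hi, interior_subset hy⟩
    rw [← Finset.sum_subset hsub fun i _ hi => ?_]
    · refine Finset.sum_congr rfl fun i hi => ?_
      have hyi : y ∈ (extChartAt 𝓘(ℂ, Model d) i).source :=
        hf i (subset_tsupport _ ((f.mem_finsupport y).1 hi))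
      have h5 (w : Model d) : toModel d i y (ofModel d x₀ y w) =
          fderiv ℂ (extChartAt 𝓘(ℂ, Model d) i ∘ (extChartAt 𝓘(ℂ, Model d) x₀).symm)
            (extChartAt 𝓘(ℂ, Model d) x₀ y) w :=
        congrArg (fun L => L w) (toModel_comp_ofModel_eq_fderiv hy₀ hyi)
      rw [h5, h5]
    · have : f i y = 0 := by
        by_contra h
        exact hi ((f.mem_finsupport y).2 h)
      rw [this, Complex.ofReal_zero, zero_mul]

end Existence

/-! ### The complexes and the homotopy equivalence -/

section Complexes

open CategoryTheory

variable {d : ℕ} {X : Type*} [TopologicalSpace X] [ChartedSpace (Model d) X]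

/-- An operator on sections as a linear map between submodules. -/
def restrictOp {M N : Submodule (HolFun d X) (RoughSection d X)}
    (op : RoughSection d X → RoughSection d X) (mem : ∀ σ ∈ M, op σ ∈ N)
    (add : ∀ σ ∈ M, ∀ τ ∈ M, op (σ + τ) = op σ + op τ)
    (smul : ∀ (f : HolFun d X), ∀ σ ∈ M, op (f • σ) = f • op σ) : M →ₗ[HolFun d X] N where
  toFun σ := ⟨op σ, mem σ σ.2⟩
  map_add' σ τ := Subtype.ext (add σ σ.2 τ τ.2)
  map_smul' f σ := Subtype.ext (smul f σ σ.2)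

theorem isCompact_closure_ne_zero {σ τ : RoughSection d X}
    (hσ : IsCompact (closure {x | σ x ≠ 0}))
    (h : ∀ x, x ∉ closure {x | σ x ≠ 0} → τ x = 0) : IsCompact (closure {x | τ x ≠ 0}) :=
  hσ.of_isClosed_subset isClosed_closure
    (closure_minimal (fun x hx => by_contra fun hn => hx (h x hn)) isClosed_closure)

theorem eq_zero_of_notMem_closure {σ : RoughSection d X} {x : X}
    (hx : x ∉ closure {x | σ x ≠ 0}) : σ x = 0 :=
  by_contra fun h => hx (subset_closure h)

/-! ### Complexes, morphisms and homotopies built from linear maps -/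

section Abstract

variable {M N : ℤ → Submodule (HolFun d X) (RoughSection d X)}
  {D : ∀ k, M k →ₗ[HolFun d X] M (k + 1)} {hD : ∀ k, D (k + 1) ∘ₗ D k = 0}
  {D' : ∀ k, N k →ₗ[HolFun d X] N (k + 1)} {hD' : ∀ k, D' (k + 1) ∘ₗ D' k = 0}

theorem complexOf_d (i : ℤ) : (complexOf M D hD).d i (i + 1) = ModuleCat.ofHom (D i) :=
  CochainComplex.of_d (fun k => ModuleCat.of (HolFun d X) (M k)) (fun k => ModuleCat.ofHom (D k)) i

theorem complexOf_d_apply {i j : ℤ} (h : i + 1 = j) (σ : M i) :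
    ((((complexOf M D hD).d i j).hom σ : M j) : RoughSection d X) = D i σ := by
  subst h
  rw [complexOf_d]
  rfl

/-- A morphism of complexes given by linear maps which commute with the differentials. -/
def complexHom (φ : ∀ k, M k →ₗ[HolFun d X] N k)
    (hφ : ∀ k (σ : M k), (D' k (φ k σ) : RoughSection d X) = φ (k + 1) (D k σ)) :
    complexOf M D hD ⟶ complexOf N D' hD' where
  f k := ModuleCat.ofHom (φ k)
  comm' i j h := by
    obtain rfl : i + 1 = j := h
    rw [complexOf_d, complexOf_d]
    exact ModuleCat.hom_ext (LinearMap.ext fun σ => Subtype.ext (hφ i σ))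

/-- A homotopy to the identity given by linear maps of degree `-1`. -/
def complexHomotopy (φ : complexOf M D hD ⟶ complexOf M D hD)
    (Q : ∀ k l : ℤ, l + 1 = k → (M k →ₗ[HolFun d X] M l))
    (hQ : ∀ k (σ : M k), (((φ.f k).hom σ : M k) : RoughSection d X) =
      (Q (k + 1) k rfl (D k σ) : RoughSection d X) + D (k - 1) (Q k (k - 1) (by omega) σ) + σ) :
    Homotopy φ (𝟙 _) where
  hom k l := if h : l + 1 = k then ModuleCat.ofHom (Q k l h) else 0
  zero k l h := dif_neg h
  comm k := by
    rw [dNext_eq _ (show (ComplexShape.up ℤ).Rel k (k + 1) from rfl),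
      prevD_eq _ (show (ComplexShape.up ℤ).Rel (k - 1) k from sub_add_cancel k 1), dif_pos rfl,
      dif_pos (sub_add_cancel k 1)]
    refine ModuleCat.hom_ext (LinearMap.ext fun σ => Subtype.ext ((hQ k σ).trans ?_))
    have h1 : (((complexOf M D hD).d k (k + 1)).hom σ : M (k + 1)) = D k σ :=
      Subtype.ext (complexOf_d_apply rfl σ)
    have h2 := complexOf_d_apply (hD := hD) (sub_add_cancel k 1)
      (Q k (k - 1) (sub_add_cancel k 1) σ)
    exact congrArg₂ (fun a b : RoughSection d X => a + b + σ)
      (congrArg (fun τ : M (k + 1) => (Q (k + 1) k rfl τ : RoughSection d X)) h1.symm) h2.symm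

end Abstract

variable [IsManifold 𝓘(ℂ, Model d) ω X]

variable {W ρ : X → ℂ} {σ τ : RoughSection d X} {k l : ℤ}

/-! ### The differential on `PV(X)` and `PV_c(X)` -/

theorem smoothOn_of_mem_PV (h : σ ∈ PV d X k) : SmoothOn σ Set.univ := isSmooth_iff.1 h.1

theorem twistedDiff_mem_PV (hW : ContMDiff 𝓘(ℂ, Model d) 𝓘(ℂ) ω W) (h : σ ∈ PV d X k) :
    twistedDiff W σ ∈ PV d X (k + 1) :=
  ⟨isSmooth_iff.2 ((smoothOn_of_mem_PV h).twistedDiff hW isOpen_univ),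
    twistedDiff_mem_totalDegree h.2⟩

theorem twistedDiff_eq_zero {x : X} (hx : x ∉ closure {x | σ x ≠ 0}) :
    twistedDiff W σ x = 0 := by
  rw [twistedDiff_apply, dbar_eq_zero_of_eqOn (O := (closure {x | σ x ≠ 0})ᶜ)
    isClosed_closure.isOpen_compl hx fun y hy => eq_zero_of_notMem_closure hy, iotaW,
    eq_zero_of_notMem_closure hx, map_zero, add_zero]

theorem twistedDiff_mem_PVc (hW : ContMDiff 𝓘(ℂ, Model d) 𝓘(ℂ) ω W) (h : σ ∈ PVc d X k) :
    twistedDiff W σ ∈ PVc d X (k + 1) :=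
  ⟨twistedDiff_mem_PV hW h.1, isCompact_closure_ne_zero h.2 fun _ hx => twistedDiff_eq_zero hx⟩

theorem twistedDiff_add_of_mem (hσ : σ ∈ PV d X k) (hτ : τ ∈ PV d X k) :
    twistedDiff W (σ + τ) = twistedDiff W σ + twistedDiff W τ := funext fun _ =>
  twistedDiff_add (smoothOn_of_mem_PV hσ) (smoothOn_of_mem_PV hτ) trivial

theorem twistedDiff_twistedDiff_of_mem (hW : ContMDiff 𝓘(ℂ, Model d) 𝓘(ℂ) ω W)
    (hσ : σ ∈ PV d X k) : twistedDiff W (twistedDiff W σ) = 0 := funext fun _ =>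
  twistedDiff_twistedDiff hW isOpen_univ (smoothOn_of_mem_PV hσ) trivial

/-- The differential of `PV(X)`. -/
def diffPV (hW : ContMDiff 𝓘(ℂ, Model d) 𝓘(ℂ) ω W) (k : ℤ) :
    PV d X k →ₗ[HolFun d X] PV d X (k + 1) :=
  restrictOp (twistedDiff W) (fun _ h => twistedDiff_mem_PV hW h)
    (fun _ hσ _ hτ => twistedDiff_add_of_mem hσ hτ)
    fun f _ hσ => twistedDiff_smul f (smoothOn_of_mem_PV hσ)

/-- The differential of `PV_c(X)`. -/
def diffPVc (hW : ContMDiff 𝓘(ℂ, Model d) 𝓘(ℂ) ω W) (k : ℤ) :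
    PVc d X k →ₗ[HolFun d X] PVc d X (k + 1) :=
  restrictOp (twistedDiff W) (fun _ h => twistedDiff_mem_PVc hW h)
    (fun _ hσ _ hτ => twistedDiff_add_of_mem hσ.1 hτ.1)
    fun f _ hσ => twistedDiff_smul f (smoothOn_of_mem_PV hσ.1)

theorem diffPV_comp (hW : ContMDiff 𝓘(ℂ, Model d) 𝓘(ℂ) ω W) (k : ℤ) :
    diffPV hW (k + 1) ∘ₗ diffPV hW k = 0 :=
  LinearMap.ext fun σ => Subtype.ext (twistedDiff_twistedDiff_of_mem hW σ.2)

theorem diffPVc_comp (hW : ContMDiff 𝓘(ℂ, Model d) 𝓘(ℂ) ω W) (k : ℤ) :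
    diffPVc hW (k + 1) ∘ₗ diffPVc hW k = 0 :=
  LinearMap.ext fun σ => Subtype.ext (twistedDiff_twistedDiff_of_mem hW σ.2.1)

/-- The inclusion `PV_c(X) → PV(X)` as a morphism of complexes. -/
def inclHom (hW : ContMDiff 𝓘(ℂ, Model d) 𝓘(ℂ) ω W) :
    complexOf (PVc d X) (diffPVc hW) (diffPVc_comp hW) ⟶
      complexOf (PV d X) (diffPV hW) (diffPV_comp hW) :=
  complexHom (fun k => incl k) fun _ _ => rfl

/-! ### The operators `𝓡` and `π` on the complexes -/

variable {G : HermitianMetric d X}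

theorem homotopyOp_add (σ τ : RoughSection d X) :
    homotopyOp G W ρ (σ + τ) = homotopyOp G W ρ σ + homotopyOp G W ρ τ := funext fun x => by
  rw [add_apply, homotopyOp, homotopyOp, homotopyOp, add_apply, mul_add, smul_add]

theorem homotopyOp_smul (f : HolFun d X) (σ : RoughSection d X) :
    homotopyOp G W ρ (f • σ) = f • homotopyOp G W ρ σ := funext fun x => by
  rw [smul_apply, homotopyOp, homotopyOp, smul_apply, mul_smul_comm, smul_comm]

theorem inverseOp_add (σ τ : RoughSection d X) :
    inverseOp G W ρ (σ + τ) = inverseOp G W ρ σ + inverseOp G W ρ τ := funext fun x => by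
  rw [add_apply, inverseOp_apply, inverseOp_apply, inverseOp_apply, add_apply, mul_add, mul_add,
    smul_add]
  abel

theorem inverseOp_smul (f : HolFun d X) (σ : RoughSection d X) :
    inverseOp G W ρ (f • σ) = f • inverseOp G W ρ σ := funext fun x => by
  rw [smul_apply, inverseOp_apply, inverseOp_apply, smul_apply, mul_smul_comm, mul_smul_comm,
    smul_add, smul_comm (ρ x)]

section Cutoff

variable (hW : ContMDiff 𝓘(ℂ, Model d) 𝓘(ℂ) ω W) (hO : IsOpen (criticalSet d W)ᶜ)
  (hρ : IsCutoff (d := d) W ρ)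

include hW hO hρ

theorem homotopyOp_mem_PV (hl : l + 1 = k) (h : σ ∈ PV d X k) :
    homotopyOp G W ρ σ ∈ PV d X l :=
  ⟨isSmooth_iff.2 (smoothOn_homotopyOp hW hO hρ (smoothOn_of_mem_PV h)),
    homotopyOp_mem_totalDegree hl h.2⟩

theorem homotopyOp_mem_PVc (hl : l + 1 = k) (h : σ ∈ PVc d X k) :
    homotopyOp G W ρ σ ∈ PVc d X l :=
  ⟨homotopyOp_mem_PV hW hO hρ hl h.1, isCompact_closure_ne_zero h.2 fun x hx => by
    rw [homotopyOp, eq_zero_of_notMem_closure hx, mul_zero, smul_zero]⟩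

/-- In this form `π` inherits smoothness and degree from `𝓡` and `δ_W`, with no separate study of
`(∂̄ρ) R` near `Z_W`. -/
theorem inverseOp_eq (h : σ ∈ PV d X k) : inverseOp G W ρ σ =
    σ - (twistedDiff W (homotopyOp G W ρ σ) + homotopyOp G W ρ (twistedDiff W σ)) :=
  funext fun x => by
    have h1 := twistedDiff_homotopyOp (G := G) hW hO hρ (smoothOn_of_mem_PV h) x
    exact (sub_sub_cancel (σ x) (inverseOp G W ρ σ x)).symm.trans
      (congrArg (σ x - ·) h1.symm)

theorem inverseOp_mem_PV (h : σ ∈ PV d X k) : inverseOp G W ρ σ ∈ PV d X k := by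
  rw [inverseOp_eq hW hO hρ h]
  refine Submodule.sub_mem _ h (Submodule.add_mem _ ?_ ?_)
  · have := twistedDiff_mem_PV hW (homotopyOp_mem_PV (G := G) hW hO hρ (sub_add_cancel k 1) h)
    rwa [sub_add_cancel] at this
  · exact homotopyOp_mem_PV hW hO hρ rfl (twistedDiff_mem_PV hW h)

/-- Both `ρ` and `∂̄ρ` vanish off the compact support of `ρ`, whatever the support of `σ`. -/
theorem inverseOp_mem_PVc (h : σ ∈ PV d X k) : inverseOp G W ρ σ ∈ PVc d X k := by
  refine ⟨inverseOp_mem_PV hW hO hρ h, hρ.compact.of_isClosed_subset isClosed_closure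
    (closure_minimal (fun x hx => by_contra fun hn => hx ?_) (isClosed_tsupport ρ))⟩
  rw [inverseOp_apply, image_eq_zero_of_notMem_tsupport hn, zero_smul,
    dbar_eq_zero_of_eqOn (O := (tsupport ρ)ᶜ) (isClosed_tsupport ρ).isOpen_compl hn fun y hy => ?_,
    zero_mul, add_zero]
  rw [scalarSec, image_eq_zero_of_notMem_tsupport hy, map_zero]

/-- Because `δ_W² = 0`, both `δ_W π` and `π δ_W` equal `δ_W - δ_W 𝓡 δ_W`. -/
theorem twistedDiff_inverseOp (h : σ ∈ PV d X k) :
    twistedDiff W (inverseOp G W ρ σ) = inverseOp G W ρ (twistedDiff W σ) := by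
  have h1 := inverseOp_eq (G := G) hW hO hρ h
  have hQ := homotopyOp_mem_PV (G := G) hW hO hρ (sub_add_cancel k 1) h
  have hδQ := twistedDiff_mem_PV hW hQ
  rw [sub_add_cancel] at hδQ
  have hQδ := homotopyOp_mem_PV (G := G) hW hO hρ rfl (twistedDiff_mem_PV hW h)
  have hσ : σ = inverseOp G W ρ σ +
      (twistedDiff W (homotopyOp G W ρ σ) + homotopyOp G W ρ (twistedDiff W σ)) := by
    rw [h1, sub_add_cancel]
  have h2 : twistedDiff W σ = twistedDiff W (inverseOp G W ρ σ) +
      twistedDiff W (homotopyOp G W ρ (twistedDiff W σ)) := by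
    conv_lhs => rw [hσ]
    rw [twistedDiff_add_of_mem (inverseOp_mem_PV hW hO hρ h) (Submodule.add_mem _ hδQ hQδ),
      twistedDiff_add_of_mem hδQ hQδ, twistedDiff_twistedDiff_of_mem hW hQ, zero_add]
  have h0 : homotopyOp G W ρ (0 : RoughSection d X) = 0 := funext fun x => by
    change (1 - ρ x) • (bigR G W x * 0) = 0
    rw [mul_zero, smul_zero]
  rw [inverseOp_eq hW hO hρ (twistedDiff_mem_PV hW h), twistedDiff_twistedDiff_of_mem hW h, h0,
    add_zero]
  exact eq_sub_of_add_eq h2.symm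

/-- The operator `π`. -/
def inversePV (G : HermitianMetric d X) (k : ℤ) : PV d X k →ₗ[HolFun d X] PVc d X k :=
  restrictOp (inverseOp G W ρ) (fun _ h => inverseOp_mem_PVc hW hO hρ h)
    (fun _ _ _ _ => inverseOp_add _ _) fun _ _ _ => inverseOp_smul _ _

/-- The operator `-𝓡` on `PV(X)`. -/
def homotopyPV (G : HermitianMetric d X) (k l : ℤ) (hl : l + 1 = k) :
    PV d X k →ₗ[HolFun d X] PV d X l :=
  restrictOp (fun σ => -homotopyOp G W ρ σ)
    (fun _ h => Submodule.neg_mem _ (homotopyOp_mem_PV hW hO hρ hl h))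
    (fun _ _ _ _ => by rw [homotopyOp_add, neg_add])
    fun _ _ _ => by rw [homotopyOp_smul, smul_neg]

/-- The operator `-𝓡` on `PV_c(X)`. -/
def homotopyPVc (G : HermitianMetric d X) (k l : ℤ) (hl : l + 1 = k) :
    PVc d X k →ₗ[HolFun d X] PVc d X l :=
  restrictOp (fun σ => -homotopyOp G W ρ σ)
    (fun _ h => Submodule.neg_mem _ (homotopyOp_mem_PVc hW hO hρ hl h))
    (fun _ _ _ _ => by rw [homotopyOp_add, neg_add])
    fun _ _ _ => by rw [homotopyOp_smul, smul_neg]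

/-- A `Homotopy φ (𝟙 _)` with maps `h` means `φ = h d + d h + 𝟙`, so here `h` is `-𝓡`. -/
theorem inverseOp_eq_neg (h : σ ∈ PV d X k) : inverseOp G W ρ σ =
    -homotopyOp G W ρ (twistedDiff W σ) + twistedDiff W (-homotopyOp G W ρ σ) + σ := by
  have hQ := homotopyOp_mem_PV (G := G) hW hO hρ (sub_add_cancel k 1) h
  -- Additivity of `twistedDiff` is established for smooth sections, so the sign is moved through
  -- the linear map `diffPV`.
  have h1 : twistedDiff W (-homotopyOp G W ρ σ) = -twistedDiff W (homotopyOp G W ρ σ) := by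
    have := (diffPV hW (k - 1)).map_neg ⟨_, hQ⟩
    exact congrArg Subtype.val this
  rw [h1, inverseOp_eq hW hO hρ h]
  abel

/-- The homotopy equivalence given by a Hermitian metric and a cutoff function. -/
def homotopyEquivPV (G : HermitianMetric d X) :
    HomotopyEquiv (complexOf (PVc d X) (diffPVc hW) (diffPVc_comp hW))
      (complexOf (PV d X) (diffPV hW) (diffPV_comp hW)) where
  hom := inclHom hW
  inv := complexHom (inversePV hW hO hρ G) fun _ σ => twistedDiff_inverseOp hW hO hρ σ.2
  homotopyHomInvId := complexHomotopy _ (homotopyPVc hW hO hρ G)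
    fun _ σ => inverseOp_eq_neg hW hO hρ σ.2.1
  homotopyInvHomId := complexHomotopy _ (homotopyPV hW hO hρ G)
    fun _ σ => inverseOp_eq_neg hW hO hρ σ.2

theorem homotopyEquivPV_homotopyInvHomId_apply (G : HermitianMetric d X) (k : ℤ) (σ : PV d X k) :
    ((((homotopyEquivPV hW hO hρ G).homotopyInvHomId.hom k (k - 1)).hom σ : PV d X (k - 1)) :
      RoughSection d X) = -homotopyOp G W ρ σ := by
  have h : (homotopyEquivPV hW hO hρ G).homotopyInvHomId.hom k (k - 1) =
      ModuleCat.ofHom (homotopyPV hW hO hρ G k (k - 1) (sub_add_cancel k 1)) :=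
    dif_pos (sub_add_cancel k 1)
  rw [h]
  rfl

theorem homotopyEquivPV_homotopyHomInvId_apply (G : HermitianMetric d X) (k : ℤ)
    (σ : PVc d X k) :
    ((((homotopyEquivPV hW hO hρ G).homotopyHomInvId.hom k (k - 1)).hom σ : PVc d X (k - 1)) :
      RoughSection d X) = -homotopyOp G W ρ σ := by
  have h : (homotopyEquivPV hW hO hρ G).homotopyHomInvId.hom k (k - 1) =
      ModuleCat.ofHom (homotopyPVc hW hO hρ G k (k - 1) (sub_add_cancel k 1)) :=
    dif_pos (sub_add_cancel k 1)
  rw [h]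
  rfl

end Cutoff

end Complexes

end PolyvectorForms

end

open PolyvectorForms in
theorem mainTheorem4 (d : ℕ) (X : Type*) [TopologicalSpace X] [T2Space X] [ParacompactSpace X]
    [ConnectedSpace X] [ChartedSpace (Model d) X] [IsManifold 𝓘(ℂ, Model d) ω X]
    (W : X → ℂ) (hW : ContMDiff 𝓘(ℂ, Model d) 𝓘(ℂ) ω W)
    (hZ : IsCompact (criticalSet d W)) :
    -- `δ_W` makes `PV(X)` and `PV_c(X)` into complexes of `O(X)`-modules, ...
    ∃ (D : ∀ k, PV d X k →ₗ[HolFun d X] PV d X (k + 1))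
      (Dc : ∀ k, PVc d X k →ₗ[HolFun d X] PVc d X (k + 1))
      (hD : ∀ k, D (k + 1) ∘ₗ D k = 0) (hDc : ∀ k, Dc (k + 1) ∘ₗ Dc k = 0)
      (i : complexOf (PVc d X) Dc hDc ⟶ complexOf (PV d X) D hD),
      (∀ k (σ : PV d X k), (D k σ : RoughSection d X) = twistedDiff W σ) ∧
      (∀ k (σ : PVc d X k), (Dc k σ : RoughSection d X) = twistedDiff W σ) ∧
      -- ... the inclusion `i` is a morphism of complexes, ...
      (∀ k, i.f k = ModuleCat.ofHom (incl k)) ∧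
      -- ... it is a homotopy equivalence and a quasi-isomorphism, ...
      (∃ e : HomotopyEquiv (complexOf (PVc d X) Dc hDc) (complexOf (PV d X) D hD), e.hom = i) ∧
      QuasiIso i ∧
      -- ... and explicit homotopy inverse and homotopies are given by every Hermitian metric and
      -- every cutoff function.
      Nonempty (HermitianMetric d X) ∧ (∃ ρ : X → ℂ, IsCutoff (d := d) W ρ) ∧
      ∀ (G : HermitianMetric d X) (ρ : X → ℂ), IsCutoff (d := d) W ρ →
        ∃ e : HomotopyEquiv (complexOf (PVc d X) Dc hDc) (complexOf (PV d X) D hD),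
          e.hom = i ∧
          (∀ k (σ : PV d X k), ((e.inv.f k).hom σ : PVc d X k) = inverseOp G W ρ σ) ∧
          (∀ k (σ : PV d X k), ((e.homotopyInvHomId.hom k (k - 1)).hom σ : PV d X (k - 1)) =
            -homotopyOp G W ρ σ) ∧
          (∀ k (σ : PVc d X k), ((e.homotopyHomInvId.hom k (k - 1)).hom σ : PVc d X (k - 1)) =
            -homotopyOp G W ρ σ) := by
  have := ChartedSpace.locallyCompactSpace (Model d) X
  -- `σ`-compactness is what the existence of partitions of unity and bump functions rests on.
  have := sigmaCompactSpace_of_connected X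
  have hO : IsOpen (criticalSet d W)ᶜ := hZ.isClosed.isOpen_compl
  obtain ⟨G₀⟩ := nonempty_hermitianMetric d X
  obtain ⟨ρ₀, hρ₀⟩ := exists_isCutoff d X W hZ
  refine ⟨diffPV hW, diffPVc hW, diffPV_comp hW, diffPVc_comp hW, inclHom hW, fun _ _ => rfl,
    fun _ _ => rfl, fun _ => rfl, ⟨homotopyEquivPV hW hO hρ₀ G₀, rfl⟩,
    (homotopyEquivPV hW hO hρ₀ G₀).quasiIso_hom, ⟨G₀⟩, ⟨ρ₀, hρ₀⟩, fun G ρ hρ =>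
    ⟨homotopyEquivPV hW hO hρ G, rfl, fun _ _ => rfl,
      homotopyEquivPV_homotopyInvHomId_apply hW hO hρ G,
      homotopyEquivPV_homotopyHomInvId_apply hW hO hρ G⟩⟩
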